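/- Let $\Bbbk$ be an algebraically closed field of characteristic $0$, let $G$ be a connected reductive linear algebraic group over $\Bbbk$ (realised as a Zariski closed subgroup of some $GL_n(\Bbbk)$) with Lie algebra $\mathfrak g$, and let $H\subset G$ be any algebraic (i.e. Zariski closed) subgroup, with Lie algebra $\mathfrak h\subset\mathfrak g$. Let $\mathfrak m=\mathfrak h^\perp=\{\xi\in\mathfrak g^*\mid \xi|_{\mathfrak h}=0\}$. The group $G$ acts on $\mathfrak g^*$ by the coadjoint representation; for $x\in\mathfrak g^*$ and a subspace $\mathfrak k\subset\mathfrak g$ write $[\mathfrak k,x]=\{[y,x]\mid y\in\mathfrak k\}$, where $[y,x]=-x([y,\cdot\,])$ is the coadjoint action of $\mathfrak g$ on $\mathfrak g^*$. Dimensions of orbits are dimensions of algebraic varieties (equivalently, of their Zariski closures). Then for every $x\in\mathfrak m$: (i) $\dim G\cdot x=\dim H\cdot x+\dim([\mathfrak g,x]\cap\mathfrak m)\ \ge\ 2\dim H\cdot x$; (ii) $\dim G\cdot x=2\dim H\cdot x$ if and only if $[\mathfrak g,x]\cap\mathfrak m=[\mathfrak h,x]$. The same holds inside $\mathfrak g$: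 for every non-degenerate $G$-invariant bilinear form $\Psi$ on $\mathfrak g$, assertions (i) and (ii) hold for every $x\in\mathfrak m_\Psi=\{x\in\mathfrak g\mid \Psi(x,y)=0\ \text{for all } y\in\mathfrak h\}$, with $\mathfrak m_\Psi$ in place of $\mathfrak m$, the adjoint action of $G$ on $\mathfrak g$ in place of the coadjoint one, and $[\cdot,\cdot]$ the bracket of $\mathfrak g$. -/

import Mathlib

open scoped Topology

attribute [local instance 100] LieRing.ofAssociativeRing

noncomputable section

namespace AlgGrp

variable {k : Type*} [Field k] {n : ℕ}

/-! ## Zariski closed subgroups of `GL n` -/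

/-- The matrix entries of `g`, as a point of affine `n²`-space. -/
def coords (A : Matrix (Fin n) (Fin n) k) : Fin n × Fin n → k := fun p => A p.1 p.2

/-- The ideal of all polynomials in the matrix entries that vanish on `S ⊆ GL n`. -/
def idealOf (S : Set (GL (Fin n) k)) : Ideal (MvPolynomial (Fin n × Fin n) k) where
  carrier := {f | ∀ g ∈ S, MvPolynomial.eval (coords (g : Matrix (Fin n) (Fin n) k)) f = 0}
  zero_mem' := fun _ _ => map_zero _
  add_mem' := fun ha hb g hg => by rw [map_add, ha g hg, hb g hg, add_zero]
  smul_mem' := fun c f hf g hg => by rw [smul_eq_mul, map_mul, hf g hg, mul_zero]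

lemma mem_idealOf {S : Set (GL (Fin n) k)} {f : MvPolynomial (Fin n × Fin n) k} :
    f ∈ idealOf S ↔
      ∀ g ∈ S, MvPolynomial.eval (coords (g : Matrix (Fin n) (Fin n) k)) f = 0 :=
  Iff.rfl

/-- The common zeros in `GL n` of a set of polynomials in the matrix entries. -/
def zeros (T : Set (MvPolynomial (Fin n × Fin n) k)) : Set (GL (Fin n) k) :=
  {g | ∀ f ∈ T, MvPolynomial.eval (coords (g : Matrix (Fin n) (Fin n) k)) f = 0}

/-- The Zariski topology on `GL n`: the closed sets are the sets of common zeros of polynomials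
in the matrix entries. (Allowing also the inverse of the determinant gives the same sets.) -/
@[reducible]
def zariskiTopology (k : Type*) [Field k] (n : ℕ) : TopologicalSpace (GL (Fin n) k) :=
  TopologicalSpace.ofClosed {S | ∃ T, S = zeros T}
    ⟨{1}, by ext g; simp [zeros]⟩
    (fun A hA => ⟨{f | ∃ T, f ∈ T ∧ zeros T ∈ A}, by
      ext g
      constructor
      · rintro hg f ⟨T, hf, hT⟩
        exact hg _ hT f hf
      · intro hg S hS
        obtain ⟨T, rfl⟩ := hA hS
        exact fun f hf => hg f ⟨T, hf, hS⟩⟩)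
    (by
      rintro _ ⟨T, rfl⟩ _ ⟨T', rfl⟩
      refine ⟨{f | ∃ a ∈ T, ∃ b ∈ T', f = a * b}, ?_⟩
      ext g
      constructor
      · rintro (hg | hg) f ⟨a, ha, b, hb, rfl⟩
        · rw [map_mul, hg a ha, zero_mul]
        · rw [map_mul, hg b hb, mul_zero]
      · intro hg
        by_contra hcon
        simp only [zeros, Set.mem_union, Set.mem_ofPred_eq, not_or, not_forall] at hcon
        obtain ⟨⟨a, ha, ha'⟩, b, hb, hb'⟩ := hcon
        have := hg (a * b) ⟨a, ha, b, hb, rfl⟩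
        rw [map_mul] at this
        exact (mul_ne_zero ha' hb') this)

lemma isClosed_zariski_iff {S : Set (GL (Fin n) k)} :
    IsClosed[zariskiTopology k n] S ↔ ∃ T, S = zeros T := by
  rw [← @isOpen_compl_iff _ _ (zariskiTopology k n)]
  change Sᶜᶜ ∈ {S | ∃ T, S = zeros T} ↔ _
  rw [compl_compl]
  rfl

/-- `G` is a linear algebraic group: a Zariski closed subgroup of `GL n`. -/
def IsAlgebraic (G : Subgroup (GL (Fin n) k)) : Prop :=
  IsClosed[zariskiTopology k n] (G : Set (GL (Fin n) k))

/-- `G` is connected in the Zariski topology. -/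
def IsConn (G : Subgroup (GL (Fin n) k)) : Prop :=
  @IsConnected _ (zariskiTopology k n) (G : Set (GL (Fin n) k))

/-- All elements of `G` are unipotent. -/
def IsUnipotentGroup (G : Subgroup (GL (Fin n) k)) : Prop :=
  ∀ g ∈ G, IsNilpotent ((g : Matrix (Fin n) (Fin n) k) - 1)

/-- `G` is a connected reductive group: a connected algebraic group whose unipotent radical is
trivial, i.e. that has no nontrivial closed connected normal unipotent subgroup. -/
structure IsConnReductive (G : Subgroup (GL (Fin n) k)) : Prop where
  isAlgebraic : IsAlgebraic G
  isConn : IsConn G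
  unipotentRadical_trivial : ∀ N : Subgroup (GL (Fin n) k), N ≤ G → IsAlgebraic N → IsConn N →
    (∀ g ∈ G, ∀ u ∈ N, g * u * g⁻¹ ∈ N) → IsUnipotentGroup N → N = ⊥

/-! ## The Lie algebra -/

/-- The derivative of the polynomial `f` at the matrix `A` in the direction `X`. -/
def dirDeriv (A X : Matrix (Fin n) (Fin n) k) (f : MvPolynomial (Fin n × Fin n) k) : k :=
  ∑ p : Fin n × Fin n, MvPolynomial.eval (coords A) (MvPolynomial.pderiv p f) * X p.1 p.2

lemma dirDeriv_add (A X : Matrix (Fin n) (Fin n) k) (f g : MvPolynomial (Fin n × Fin n) k) :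
    dirDeriv A X (f + g) = dirDeriv A X f + dirDeriv A X g := by
  simp [dirDeriv, add_mul, Finset.sum_add_distrib]

lemma dirDeriv_C (A X : Matrix (Fin n) (Fin n) k) (a : k) :
    dirDeriv A X (MvPolynomial.C a) = 0 := by
  simp [dirDeriv]

lemma dirDeriv_X (A X : Matrix (Fin n) (Fin n) k) (p : Fin n × Fin n) :
    dirDeriv A X (MvPolynomial.X p) = X p.1 p.2 := by
  classical
  rw [dirDeriv, Finset.sum_eq_single p]
  · simp
  · intro q _ hq
    rw [MvPolynomial.pderiv_X_of_ne hq.symm]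
    simp
  · simp

lemma dirDeriv_mul (A X : Matrix (Fin n) (Fin n) k) (f g : MvPolynomial (Fin n × Fin n) k) :
    dirDeriv A X (f * g) = MvPolynomial.eval (coords A) f * dirDeriv A X g
      + MvPolynomial.eval (coords A) g * dirDeriv A X f := by
  simp only [dirDeriv, Finset.mul_sum, ← Finset.sum_add_distrib]
  refine Finset.sum_congr rfl fun p _ => ?_
  simp [Derivation.leibniz]
  ring

lemma dirDeriv_sum {ι : Type*} (s : Finset ι) (A X : Matrix (Fin n) (Fin n) k)
    (f : ι → MvPolynomial (Fin n × Fin n) k) :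
    dirDeriv A X (∑ i ∈ s, f i) = ∑ i ∈ s, dirDeriv A X (f i) := by
  classical
  induction s using Finset.induction_on with
  | empty => simp [dirDeriv]
  | insert a s ha ih => rw [Finset.sum_insert ha, Finset.sum_insert ha, dirDeriv_add, ih]

/-- The substitution `f(x) ↦ f(P x Q)`. -/
def subst (P Q : Matrix (Fin n) (Fin n) k) :
    MvPolynomial (Fin n × Fin n) k →ₐ[k] MvPolynomial (Fin n × Fin n) k :=
  MvPolynomial.aeval fun p => ∑ i, ∑ j,
    MvPolynomial.C (P p.1 i * Q j p.2) * MvPolynomial.X (i, j)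

lemma mul_mul_apply' (P A Q : Matrix (Fin n) (Fin n) k) (a b : Fin n) :
    (P * A * Q) a b = ∑ i, ∑ j, P a i * Q j b * A i j := by
  simp only [Matrix.mul_apply, Finset.sum_mul]
  rw [Finset.sum_comm]
  refine Finset.sum_congr rfl fun i _ => Finset.sum_congr rfl fun j _ => ?_
  ring

lemma eval_subst (P Q A : Matrix (Fin n) (Fin n) k) (f : MvPolynomial (Fin n × Fin n) k) :
    MvPolynomial.eval (coords A) (subst P Q f) = MvPolynomial.eval (coords (P * A * Q)) f := by
  induction f using MvPolynomial.induction_on with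
  | C a => simp [subst]
  | add f g hf hg => simp [hf, hg]
  | mul_X f p hf =>
    rw [map_mul, map_mul, hf, map_mul]
    congr 1
    simp [subst, coords, mul_mul_apply']

lemma dirDeriv_subst (P Q A X : Matrix (Fin n) (Fin n) k)
    (f : MvPolynomial (Fin n × Fin n) k) :
    dirDeriv A X (subst P Q f) = dirDeriv (P * A * Q) (P * X * Q) f := by
  induction f using MvPolynomial.induction_on with
  | C a =>
    have : subst P Q (MvPolynomial.C a) = MvPolynomial.C a := by simp [subst]
    rw [this, dirDeriv_C, dirDeriv_C]
  | add f g hf hg => rw [map_add, dirDeriv_add, dirDeriv_add, hf, hg]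
  | mul_X f p hf =>
    rw [map_mul, dirDeriv_mul, dirDeriv_mul, hf, eval_subst, eval_subst]
    congr 2
    rw [dirDeriv_X, mul_mul_apply']
    simp [subst, dirDeriv_sum, dirDeriv_mul, dirDeriv_C, dirDeriv_X]

/-- The left-invariant vector field on matrices with value `X` at `1`. -/
def leftInvDer (X : Matrix (Fin n) (Fin n) k) :
    Derivation k (MvPolynomial (Fin n × Fin n) k) (MvPolynomial (Fin n × Fin n) k) :=
  MvPolynomial.mkDerivation k fun p =>
    ∑ l, MvPolynomial.C (X l p.2) * MvPolynomial.X (p.1, l)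

lemma eval_leftInvDer (A X : Matrix (Fin n) (Fin n) k) (f : MvPolynomial (Fin n × Fin n) k) :
    MvPolynomial.eval (coords A) (leftInvDer X f) = dirDeriv A (A * X) f := by
  induction f using MvPolynomial.induction_on with
  | C a => simp [leftInvDer, dirDeriv_C]
  | add f g hf hg => rw [map_add, map_add, dirDeriv_add, hf, hg]
  | mul_X f p hf =>
    rw [Derivation.leibniz, dirDeriv_mul, dirDeriv_X, map_add, smul_eq_mul, smul_eq_mul, map_mul,
      map_mul, hf]
    congr 2
    simp [leftInvDer, coords, Matrix.mul_apply, mul_comm]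

lemma leftInvDer_lie (X Y : Matrix (Fin n) (Fin n) k) :
    ⁅leftInvDer X, leftInvDer Y⁆ = leftInvDer ⁅X, Y⁆ := by
  have hC : ∀ (Z : Matrix (Fin n) (Fin n) k) (a : k), leftInvDer Z (MvPolynomial.C a) = 0 :=
    fun Z a => MvPolynomial.derivation_C _ a
  have hX : ∀ (Z : Matrix (Fin n) (Fin n) k) (p : Fin n × Fin n),
      leftInvDer Z (MvPolynomial.X p)
        = ∑ l, MvPolynomial.C (Z l p.2) * MvPolynomial.X (p.1, l) :=
    fun Z p => MvPolynomial.mkDerivation_X _ _ p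
  refine MvPolynomial.derivation_ext fun p => ?_
  rw [Derivation.commutator_apply]
  simp only [hX, hC, map_sum, Derivation.leibniz, mul_zero, add_zero, smul_eq_mul, Ring.lie_def,
    Matrix.sub_apply, Matrix.mul_apply, map_sub, sub_mul, Finset.sum_sub_distrib, Finset.mul_sum,
    Finset.sum_mul, map_mul]
  congr 1
  · rw [Finset.sum_comm]
    exact Finset.sum_congr rfl fun i _ => Finset.sum_congr rfl fun j _ => by ring
  · rw [Finset.sum_comm]
    exact Finset.sum_congr rfl fun i _ => Finset.sum_congr rfl fun j _ => by ring

lemma leftInvDer_mem {G : Subgroup (GL (Fin n) k)} {X : Matrix (Fin n) (Fin n) k}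
    (hX : ∀ f ∈ idealOf (G : Set (GL (Fin n) k)), dirDeriv 1 X f = 0)
    {f : MvPolynomial (Fin n × Fin n) k} (hf : f ∈ idealOf (G : Set (GL (Fin n) k))) :
    leftInvDer X f ∈ idealOf (G : Set (GL (Fin n) k)) := by
  intro g hg
  rw [eval_leftInvDer]
  have h := hX (subst (g : Matrix (Fin n) (Fin n) k) 1 f) (fun u hu => by
    rw [eval_subst, mul_one]
    exact hf (g * u) (G.mul_mem hg hu))
  rwa [dirDeriv_subst, mul_one, mul_one, mul_one] at h

/-- The Lie algebra `Lie G ⊆ gl n` of an algebraic group `G ⊆ GL n`: the tangent space of `G` at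
`1`, with the commutator of matrices as bracket. -/
def lieAlg (G : Subgroup (GL (Fin n) k)) : LieSubalgebra k (Matrix (Fin n) (Fin n) k) where
  carrier := {X | ∀ f ∈ idealOf (G : Set (GL (Fin n) k)), dirDeriv 1 X f = 0}
  zero_mem' := fun f _ => by simp [dirDeriv]
  add_mem' := fun {X Y} hX hY f hf => by
    have h : dirDeriv 1 (X + Y) f = dirDeriv 1 X f + dirDeriv 1 Y f := by
      simp [dirDeriv, mul_add, Finset.sum_add_distrib]
    rw [h, hX f hf, hY f hf, add_zero]
  smul_mem' := fun c X hX f hf => by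
    have h : dirDeriv 1 (c • X) f = c * dirDeriv 1 X f := by
      simp only [dirDeriv, Matrix.smul_apply, smul_eq_mul, Finset.mul_sum]
      exact Finset.sum_congr rfl fun p _ => by ring
    rw [h, hX f hf, mul_zero]
  lie_mem' := fun {X Y} hX hY f hf => by
    have h : dirDeriv 1 ⁅X, Y⁆ f
        = dirDeriv 1 X (leftInvDer Y f) - dirDeriv 1 Y (leftInvDer X f) := by
      have e : ∀ Z (F : MvPolynomial (Fin n × Fin n) k),
          dirDeriv 1 Z F = MvPolynomial.eval (coords 1) (leftInvDer Z F) := fun Z F => by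
        rw [eval_leftInvDer, one_mul]
      rw [e, e, e, ← leftInvDer_lie, Derivation.commutator_apply, map_sub]
    rw [h, hX _ (leftInvDer_mem hY hf), hY _ (leftInvDer_mem hX hf), sub_zero]

lemma mem_lieAlg {G : Subgroup (GL (Fin n) k)} {X : Matrix (Fin n) (Fin n) k} :
    X ∈ lieAlg G ↔ ∀ f ∈ idealOf (G : Set (GL (Fin n) k)), dirDeriv 1 X f = 0 :=
  Iff.rfl

/-- For a subgroup `H` of `G`, the Lie algebra of `H` as a subspace of the Lie algebra of `G`. -/
def lieSub (G H : Subgroup (GL (Fin n) k)) : Submodule k (lieAlg G) :=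
  (lieAlg H).toSubmodule.comap (lieAlg G).toSubmodule.subtype

/-! ## The adjoint and the coadjoint representation -/

lemma conj_mem_lieAlg {G : Subgroup (GL (Fin n) k)} {g : GL (Fin n) k} (hg : g ∈ G)
    {X : Matrix (Fin n) (Fin n) k} (hX : X ∈ lieAlg G) :
    (g : Matrix (Fin n) (Fin n) k) * X * ((g⁻¹ : GL (Fin n) k) : Matrix (Fin n) (Fin n) k)
      ∈ lieAlg G := by
  intro f hf
  have h := hX (subst (g : Matrix (Fin n) (Fin n) k)
      ((g⁻¹ : GL (Fin n) k) : Matrix (Fin n) (Fin n) k) f) (fun u hu => by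
    rw [eval_subst]
    exact hf (g * u * g⁻¹) (G.mul_mem (G.mul_mem hg hu) (G.inv_mem hg)))
  rw [dirDeriv_subst] at h
  simpa using h

/-- The adjoint representation `Ad g X = g X g⁻¹` of `G` in its Lie algebra. -/
def Ad (G : Subgroup (GL (Fin n) k)) : Representation k G (lieAlg G) where
  toFun g :=
    { toFun := fun X => ⟨((g : GL (Fin n) k) : Matrix (Fin n) (Fin n) k) * X
        * (((g : GL (Fin n) k)⁻¹ : GL (Fin n) k) : Matrix (Fin n) (Fin n) k),
          conj_mem_lieAlg g.2 X.2⟩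
      map_add' := fun X Y => Subtype.ext (by simp [mul_add, add_mul])
      map_smul' := fun c X => Subtype.ext (by simp) }
  map_one' := by ext X; simp
  map_mul' g h := LinearMap.ext fun X => Subtype.ext (by simp [mul_assoc])

/-- The coadjoint representation `(g · ξ)(Y) = ξ(Ad g⁻¹ Y)` of `G` in the dual of its Lie
algebra. -/
def coAd (G : Subgroup (GL (Fin n) k)) : Representation k G (Module.Dual k (lieAlg G)) :=
  (Ad G).dual

/-- For a subgroup `H` of `G`, the orbit `H · x` of `x` in a representation of `G`. -/
def orbit {V : Type*} [AddCommGroup V] [Module k V] {G : Subgroup (GL (Fin n) k)}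
    (ρ : Representation k G V) (H : Subgroup (GL (Fin n) k)) (x : V) : Set V :=
  {y | ∃ g : G, (g : GL (Fin n) k) ∈ H ∧ y = ρ g x}

/-- For a subspace `K` of a Lie algebra and an element `x` of a Lie module, the subspace
`[K, x] = {⁅X, x⁆ | X ∈ K}`. -/
def bracketSpace {L M : Type*} [LieRing L] [LieAlgebra k L] [AddCommGroup M] [Module k M]
    [LieRingModule L M] [LieModule k L M] (K : Submodule k L) (x : M) : Submodule k M :=
  K.map ((LieModule.toEnd k L M : L →ₗ[k] Module.End k M).flip x)

lemma mem_bracketSpace {L M : Type*} [LieRing L] [LieAlgebra k L] [AddCommGroup M] [Module k M]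
    [LieRingModule L M] [LieModule k L M] {K : Submodule k L} {x y : M} :
    y ∈ bracketSpace K x ↔ ∃ X ∈ K, ⁅X, x⁆ = y :=
  Iff.rfl

/-! ## Dimension -/

/-- The algebra `k[S]` of the restrictions to `S` of the polynomial functions on the vector space
`V` (the functions generated by the linear forms). It is the coordinate ring of the Zariski
closure of `S`. -/
def coordRing {V : Type*} [AddCommGroup V] [Module k V] (S : Set V) : Subalgebra k (S → k) :=
  Algebra.adjoin k (Set.range fun (l : Module.Dual k V) (s : S) => l s)

/-- The dimension of a locally closed subset `S` (for example, of an orbit of an algebraic group)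
of a finite-dimensional vector space, that is, the dimension of the affine variety `closure S`:
the Krull dimension of the coordinate ring of the Zariski closure of `S`. -/
def dimension {V : Type*} [AddCommGroup V] [Module k V] (S : Set V) : WithBot ℕ∞ :=
  ringKrullDim (coordRing (k := k) S)

/-- A bilinear form on the Lie algebra of `G` is `G`-invariant. -/
def IsInvariantForm {G : Subgroup (GL (Fin n) k)} (Ψ : LinearMap.BilinForm k (lieAlg G)) : Prop :=
  ∀ (g : G) (X Y : lieAlg G), Ψ (Ad G g X) (Ad G g Y) = Ψ X Y

end AlgGrp

end

namespace AlgGrp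

/-! Write 𝔤 and 𝔥 for the two Lie algebras. Once dim H·x = dim [𝔥, x], and likewise for G, the
theorem is linear algebra of the skew form (X, Y) ↦ -x([X, Y]). Restriction to 𝔥 of the functionals
in [𝔤, x] has kernel [𝔤, x] ∩ 𝔪. By skewness its image is the range of the transpose of X ↦ [X, x]
on 𝔥, so it has dimension dim [𝔥, x] (`finrank_bracketSpace_top`). Since x vanishes on the
subalgebra 𝔥, [𝔥, x] lies in [𝔤, x] ∩ 𝔪 (`bracketSpace_le_inf_dualAnnihilator`), which gives the
inequality and the case of equality.

The dimension formula `dimension_orbit_coAd` comes from tangent spaces. The orbit map is a dominant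
morphism from H to the closure of H·x, and its differential at h has image h·[𝔥, x]
(`finrank_tangentImage_orbitComorphism`), of the same dimension for every h. In characteristic 0, a
dominant morphism whose differential has rank r at all points has a target of dimension r
(`ringKrullDim_eq_of_finrank_tangentImage`). Indeed, let s be the number of Noether parameters of
the target. The rank is at most s somewhere, because at a general point a tangent vector in the
image is determined by its values on the parameters. It is at least s somewhere, because derivations
dual to the parameters exist on a function field and can be specialised.

A nondegenerate invariant Ψ is a G-equivariant isomorphism 𝔤 ≅ 𝔤*, which transports the coadjoint
statement to the adjoint one. -/

/-! ### Commutative algebra: closed points, integral extensions, minimal primes. -/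

theorem exists_algHom_apply_ne_zero {k R : Type*} [Field k] [IsAlgClosed k] [CommRing R]
    [Algebra k R] [Algebra.FiniteType k R] [IsReduced R] {w : R} (hw : w ≠ 0) :
    ∃ q : R →ₐ[k] k, q w ≠ 0 := by
  -- Nullstellensatz: in a reduced Jacobson ring the maximal ideals meet in 0, so one of them misses
  -- `w`; its residue field is finite over `k`, hence equal to `k`.
  have : IsJacobsonRing R := isJacobsonRing_of_finiteType (A := k)
  have hj : (⊥ : Ideal R).jacobson = ⊥ :=
    isJacobsonRing_iff.mp this ⊥ (by
      rw [← Ideal.radical_eq_iff]; exact nilradical_eq_zero R)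
  have hw' : w ∉ (⊥ : Ideal R).jacobson := by rw [hj]; simpa using hw
  simp only [Ideal.jacobson, Ideal.mem_sInf, not_forall] at hw'
  obtain ⟨m, ⟨-, hm⟩, hwm⟩ := hw'
  let := Ideal.Quotient.field m
  have : Algebra.FiniteType k (R ⧸ m) :=
    Algebra.FiniteType.of_surjective (Ideal.Quotient.mkₐ k m) (Ideal.Quotient.mkₐ_surjective k m)
  have : Module.Finite k (R ⧸ m) := finite_of_finite_type_of_isJacobsonRing k (R ⧸ m)
  have hb : Function.Bijective (algebraMap k (R ⧸ m)) :=
    IsAlgClosed.algebraMap_bijective_of_isIntegral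
  let e : k ≃ₐ[k] (R ⧸ m) := AlgEquiv.ofBijective (Algebra.ofId k (R ⧸ m)) hb
  refine ⟨(e.symm : (R ⧸ m) →ₐ[k] k).comp (Ideal.Quotient.mkₐ k m), fun h => hwm ?_⟩
  have h' : e.symm (Ideal.Quotient.mk m w) = 0 := h
  rw [map_eq_zero_iff _ e.symm.injective] at h'
  exact Ideal.Quotient.eq_zero_iff_mem.mp h'

/-- Incomparability bounds chains upstairs by chains downstairs; lying over and going up lift a
chain to one of the same length. -/
theorem ringKrullDim_eq_of_isIntegral_of_injective {A B : Type*} [CommRing A] [CommRing B]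
    [Algebra A B] [Algebra.IsIntegral A B] (h : Function.Injective (algebraMap A B)) :
    ringKrullDim B = ringKrullDim A := by
  apply le_antisymm
  · refine Order.krullDim_le_of_strictMono (PrimeSpectrum.comap (algebraMap A B)) fun p q hpq => ?_
    exact Ideal.IsIntegral.comap_lt_comap (R := A) hpq
  · refine iSup_le fun l => ?_
    obtain ⟨Q, -, hQ, hQl⟩ := Ideal.exists_ideal_over_prime_of_isIntegral (S := B)
      l.head.asIdeal ⊥ (by
        rw [← RingHom.ker_eq_comap_bot, (RingHom.injective_iff_ker_eq_bot _).mp h]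
        exact bot_le)
    have : Q.LiesOver l.head.asIdeal := ⟨hQl.symm⟩
    obtain ⟨L, hL, -⟩ := Ideal.exists_ltSeries_of_hasGoingUp l Q
    rw [← hL]
    exact le_iSup (fun L : LTSeries (PrimeSpectrum B) => ((L.length : ℕ∞) : WithBot ℕ∞)) L

/-- The localization of a reduced ring at a minimal prime is a field, so `x` already vanishes there.
This lets relations modulo `p` become relations in `R` without assuming `R` a domain. -/
theorem exists_mul_eq_zero_of_mem_minimalPrimes {R : Type*} [CommRing R] [IsReduced R]
    {p : Ideal R} (hp : p ∈ minimalPrimes R) {x : R} (hx : x ∈ p) : ∃ u ∉ p, u * x = 0 := by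
  have : p.IsPrime := hp.1.1
  have : Ring.KrullDimLE 0 (Localization.AtPrime p) := .of_isLocalization p hp _
  have hf : IsField (Localization.AtPrime p) := Ring.KrullDimLE.isField_of_isReduced
  have h0 : algebraMap R (Localization.AtPrime p) x = 0 := by
    have h1 : algebraMap R (Localization.AtPrime p) x ∈
        IsLocalRing.maximalIdeal (Localization.AtPrime p) := by
      rw [IsLocalization.AtPrime.to_map_mem_maximal_iff _ p]
      exact hx
    rwa [IsLocalRing.isField_iff_maximalIdeal_eq.mp hf] at h1
  obtain ⟨u, hu⟩ := (IsLocalization.map_eq_zero_iff p.primeCompl _ x).mp h0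
  exact ⟨u, u.2, hu⟩

/-! ### Point derivations, that is, tangent vectors at closed points. -/

/-- The space of point derivations `A → k` at the `k`-point `q` of `A`. -/
def pointDer {k A : Type*} [Field k] [CommRing A] [Algebra k A] (q : A →ₐ[k] k) :
    Submodule k (A →ₗ[k] k) where
  carrier := {δ | ∀ a b, δ (a * b) = q a * δ b + q b * δ a}
  zero_mem' := fun _ _ => by simp
  add_mem' := fun {δ ε} hδ hε a b => by
    rw [LinearMap.add_apply, hδ, hε, LinearMap.add_apply, LinearMap.add_apply]; ring
  smul_mem' := fun c δ hδ a b => by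
    rw [LinearMap.smul_apply, hδ, LinearMap.smul_apply, LinearMap.smul_apply]
    simp only [smul_eq_mul]; ring

section pointDer

variable {k A R : Type*} [Field k] [CommRing A] [Algebra k A] [CommRing R] [Algebra k R]

theorem pointDer_mul {q : A →ₐ[k] k} {δ : A →ₗ[k] k} (hδ : δ ∈ pointDer q) (a b : A) :
    δ (a * b) = q a * δ b + q b * δ a := hδ a b

theorem pointDer_algebraMap {q : A →ₐ[k] k} {δ : A →ₗ[k] k} (hδ : δ ∈ pointDer q) (c : k) :
    δ (algebraMap k A c) = 0 := by
  have h1 : δ 1 = 0 := by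
    have h := hδ 1 1
    simp only [mul_one, map_one, one_mul] at h
    simpa using h
  rw [Algebra.algebraMap_eq_smul_one, map_smul, h1, smul_zero]

theorem pointDer_comp {q : R →ₐ[k] k} {δ : R →ₗ[k] k} (hδ : δ ∈ pointDer q) (φ : A →ₐ[k] R) :
    δ ∘ₗ φ.toLinearMap ∈ pointDer (q.comp φ) := fun a b => by
  simp [pointDer_mul hδ]

theorem pointDer_eq_zero_of_adjoin {q : A →ₐ[k] k} {δ : A →ₗ[k] k} (hδ : δ ∈ pointDer q)
    {s : Set A} (hs : Algebra.adjoin k s = ⊤) (h : ∀ a ∈ s, δ a = 0) : δ = 0 := by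
  ext a
  have ha : a ∈ Algebra.adjoin k s := hs ▸ Algebra.mem_top
  induction ha using Algebra.adjoin_induction with
  | mem x hx => exact h x hx
  | algebraMap c => exact pointDer_algebraMap hδ c
  | add x y _ _ hx hy => rw [map_add, hx, hy]; simp
  | mul x y _ _ hx hy => rw [hδ, hx, hy]; simp

instance finiteDimensional_pointDer [Algebra.FiniteType k A] (q : A →ₐ[k] k) :
    FiniteDimensional k (pointDer q) := by
  obtain ⟨s, hs⟩ := Algebra.FiniteType.out (R := k) (A := A)
  let f : pointDer q →ₗ[k] (s → k) :=
    { toFun := fun δ a => δ.1 a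
      map_add' := fun _ _ => rfl
      map_smul' := fun _ _ => rfl }
  refine Module.Finite.of_injective f fun δ ε h => ?_
  refine sub_eq_zero.mp (Subtype.ext (pointDer_eq_zero_of_adjoin (δ - ε).2 hs fun a ha => ?_))
  exact sub_eq_zero.mpr (congrFun h ⟨a, ha⟩)

/-- Chain rule for a polynomial whose coefficients are constants for `δ`. -/
theorem pointDer_eval₂ {B : Type*} [CommRing B] (ψ : B →+* R) {q : R →ₐ[k] k} {δ : R →ₗ[k] k}
    (hδ : δ ∈ pointDer q) (h : ∀ b, δ (ψ b) = 0) (Q : Polynomial B) (a : R) :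
    δ (Q.eval₂ ψ a) = q (Q.derivative.eval₂ ψ a) * δ a := by
  induction Q using Polynomial.induction_on' with
  | add f g hf hg =>
    simp only [Polynomial.eval₂_add, map_add, hf, hg]; ring
  | monomial n b =>
    have hpow : ∀ m : ℕ, δ (a ^ m) = q (m * a ^ (m - 1)) * δ a := by
      intro m
      induction m with
      | zero => simpa using pointDer_algebraMap hδ 1
      | succ m ih =>
        rw [pow_succ, hδ, ih]
        cases m with
        | zero => simp
        | succ m =>
          simp only [map_mul, map_pow, Nat.add_sub_cancel, Nat.cast_add, Nat.cast_one]
          simp only [map_add, map_one, map_natCast]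
          ring
    rw [Polynomial.eval₂_monomial, hδ, h, hpow, Polynomial.derivative_monomial,
      Polynomial.eval₂_monomial]
    simp only [map_mul, map_natCast, mul_zero, add_zero]
    ring

/-- Generically, a point derivation that kills the image of `ψ` kills every element that is
integral over `ψ`. -/
theorem exists_pointDer_eq_zero_of_isIntegralElem [CharZero k] [IsReduced R] {B : Type*}
    [CommRing B] (ψ : B →+* R) {p : Ideal R} (hp : p ∈ minimalPrimes R) {a : R}
    (ha : ψ.IsIntegralElem a) :
    ∃ w ∉ p, ∀ q : R →ₐ[k] k, q w ≠ 0 → ∀ δ ∈ pointDer q, (∀ b, δ (ψ b) = 0) → δ a = 0 := by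
  classical
  have : p.IsPrime := hp.1.1
  let π := Ideal.Quotient.mk p
  have : CharZero (R ⧸ p) := charZero_of_injective_algebraMap (algebraMap k (R ⧸ p)).injective
  have hev : ∀ Q : Polynomial B, (Q.map (π.comp ψ)).eval (π a) = π (Q.eval₂ ψ a) := fun Q => by
    rw [Polynomial.eval_map, Polynomial.hom_eval₂]
  -- Choose `Q` of least degree with nonzero reduction mod `p` and `Q(a) ∈ p`. In characteristic 0
  -- the reduction of `Q'` is nonzero of smaller degree, so minimality forces `Q'(a) ∉ p`.
  let P : ℕ → Prop := fun d => ∃ Q : Polynomial B, (Q.map (π.comp ψ)).natDegree = d ∧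
    Q.map (π.comp ψ) ≠ 0 ∧ Q.eval₂ ψ a ∈ p
  have hP : ∃ d, P d := by
    obtain ⟨Q, hQ, hQa⟩ := ha
    exact ⟨_, Q, rfl, (hQ.map _).ne_zero, hQa ▸ p.zero_mem⟩
  obtain ⟨Q, hd, hQ0, hQa⟩ := Nat.find_spec hP
  have hQ' : Q.derivative.eval₂ ψ a ∉ p := by
    intro hmem
    have hdeg : (Q.map (π.comp ψ)).natDegree ≠ 0 := by
      intro h0
      rw [Polynomial.eq_C_of_natDegree_eq_zero h0] at hQ0
      apply hQ0
      have := hev Q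
      rw [Polynomial.eq_C_of_natDegree_eq_zero h0, Polynomial.eval_C,
        Ideal.Quotient.eq_zero_iff_mem.mpr hQa] at this
      rw [this, Polynomial.C_0]
    have hlt : (Q.derivative.map (π.comp ψ)).natDegree < Nat.find hP := by
      rw [← hd, ← Polynomial.derivative_map]
      exact Polynomial.natDegree_derivative_lt hdeg
    refine Nat.find_min hP hlt ⟨_, rfl, ?_, hmem⟩
    rw [← Polynomial.derivative_map]
    intro h0
    exact hdeg (Polynomial.derivative_eq_zero.mp h0)
  -- `Q(a)` vanishes only mod `p`, but `u * Q(a) = 0` in `R`. Applying `δ` where `q u ≠ 0` leaves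
  -- `q(u) q(Q'(a)) δ(a) = 0`.
  obtain ⟨u, hu, hu0⟩ := exists_mul_eq_zero_of_mem_minimalPrimes hp hQa
  refine ⟨u * Q.derivative.eval₂ ψ a, fun h => ((Ideal.IsPrime.mem_or_mem ‹_› h).elim hu hQ'),
    fun q hq δ hδ hψ => ?_⟩
  rw [map_mul] at hq
  have h1 : q (Q.eval₂ ψ a) = 0 := by
    have := congrArg q hu0
    rw [map_mul, map_zero] at this
    exact (mul_eq_zero.mp this).resolve_left (left_ne_zero_of_mul hq)
  have h2 := congrArg δ hu0
  rw [hδ, h1, zero_mul, add_zero, map_zero, pointDer_eval₂ ψ hδ hψ, ← mul_assoc] at h2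
  exact (mul_eq_zero.mp h2).resolve_left hq

end pointDer

/-! ### Extension of derivations to algebraic extensions in characteristic 0. -/

open scoped TensorProduct in
-- Formal étaleness gives T ⊗ Ω_S ≅ Ω_T, so a linear map out of Ω_S with values in a `T`-module
-- factors uniquely through Ω_T.
theorem exists_derivation_of_formallyEtale {k S T : Type*} [CommRing k] [CommRing S] [CommRing T]
    [Algebra k S] [Algebra k T] [Algebra S T] [IsScalarTower k S T] [Algebra.FormallyEtale S T]
    (d : Derivation k S T) : ∃ D : Derivation k T T, ∀ s, D (algebraMap S T s) = d s := by
  let g : T ⊗[S] Ω[S⁄k] →ₗ[T] T := LinearMap.liftBaseChange T d.liftKaehlerDifferential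
  let e := KaehlerDifferential.tensorKaehlerEquivOfFormallyEtale k S T
  refine ⟨(g ∘ₗ e.symm.toLinearMap).compDer (KaehlerDifferential.D k T), fun s => ?_⟩
  change g (e.symm (KaehlerDifferential.D k T (algebraMap S T s))) = d s
  rw [KaehlerDifferential.tensorKaehlerEquivOfFormallyEtale_symm_D_algebraMap]
  simp [g]

/-- Pass through the fraction field: a localization, followed by an algebraic extension that is
separable in characteristic 0. -/
theorem formallyEtale_of_isAlgebraic (S K : Type*) [CommRing S] [IsDomain S] [CharZero S] [Field K]
    [Algebra S K] [FaithfulSMul S K] [Algebra.IsAlgebraic S K] : Algebra.FormallyEtale S K := by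
  let F := FractionRing S
  let : Algebra F K := FractionRing.liftAlgebra S K
  have : Algebra.IsAlgebraic F K := (IsFractionRing.comap_isAlgebraic_iff (A := S)).mp inferInstance
  have : CharZero F := charZero_of_injective_algebraMap (IsFractionRing.injective S F)
  have : Algebra.FormallyEtale F K := Algebra.FormallyEtale.of_isSeparable F K
  have : Algebra.FormallyEtale S F := Algebra.FormallyEtale.of_isLocalization (nonZeroDivisors S)
  exact Algebra.FormallyEtale.comp S F K

theorem exists_derivation_of_isTranscendenceBasis {k K ι : Type*} [Field k] [CharZero k] [Field K]
    [Algebra k K] {x : ι → K} (hx : IsTranscendenceBasis k x) (v : ι → K) :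
    ∃ D : Derivation k K K, ∀ j, D (x j) = v j := by
  let φ : MvPolynomial ι k →ₐ[k] K := MvPolynomial.aeval x
  have hφ : Function.Injective φ := hx.1
  let : Algebra (MvPolynomial ι k) K := φ.toRingHom.toAlgebra
  have hmap : ∀ s : MvPolynomial ι k, algebraMap (MvPolynomial ι k) K s = φ s := fun _ => rfl
  have : IsScalarTower k (MvPolynomial ι k) K := IsScalarTower.of_algebraMap_eq fun c => by
    rw [hmap, AlgHom.commutes]
  have : FaithfulSMul (MvPolynomial ι k) K := (faithfulSMul_iff_algebraMap_injective _ K).mpr hφ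
  have : Algebra.IsAlgebraic (MvPolynomial ι k) K := by
    have h := hx.isAlgebraic
    rw [Algebra.adjoin_range_eq_range_aeval] at h
    let e : MvPolynomial ι k ≃ₐ[k] φ.range := AlgEquiv.ofInjective φ hφ
    refine ⟨fun y => ?_⟩
    obtain ⟨P, hP, hPy⟩ := h.isAlgebraic y
    refine ⟨P.map (e.symm : φ.range →+* MvPolynomial ι k), ?_, ?_⟩
    · rw [Ne, Polynomial.map_eq_zero_iff e.symm.injective]
      exact hP
    · rw [Polynomial.aeval_def, Polynomial.eval₂_map]
      rw [Polynomial.aeval_def] at hPy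
      have he : (algebraMap (MvPolynomial ι k) K).comp (e.symm : φ.range →+* MvPolynomial ι k) =
          algebraMap φ.range K :=
        RingHom.ext fun z => congrArg Subtype.val (e.apply_symm_apply z)
      rw [he]
      exact hPy
  have : CharZero (MvPolynomial ι k) :=
    charZero_of_injective_algebraMap (MvPolynomial.C_injective ι k)
  have : Algebra.FormallyEtale (MvPolynomial ι k) K := formallyEtale_of_isAlgebraic _ K
  obtain ⟨D, hD⟩ := exists_derivation_of_formallyEtale (MvPolynomial.mkDerivation k v)
  refine ⟨D, fun j => ?_⟩
  have h := hD (MvPolynomial.X j)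
  rwa [hmap, MvPolynomial.aeval_X, MvPolynomial.mkDerivation_X] at h

theorem exists_derivation_of_algebraicIndependent {k K ι : Type*} [Field k] [CharZero k] [Field K]
    [Algebra k K] {f : ι → K} (hf : AlgebraicIndependent k f) (v : ι → K) :
    ∃ D : Derivation k K K, ∀ j, D (f j) = v j := by
  obtain ⟨t, hst, ht⟩ := exists_isTranscendenceBasis_superset hf.coe_range
  obtain ⟨D, hD⟩ := exists_derivation_of_isTranscendenceBasis ht
    -- The value 0 on basis elements outside the range of `f` is arbitrary.
    fun x : t => Function.extend f v 0 (x : K)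
  refine ⟨D, fun j => ?_⟩
  rw [hD ⟨f j, hst ⟨j, rfl⟩⟩, hf.injective.extend_apply]

/-! ### Rank of the differential and dimension of the target. -/

section tangentImage

variable {k A R : Type*} [Field k] [CommRing A] [Algebra k A] [CommRing R] [Algebra k R]

/-- The image of the tangent space of `R` at `q` under the differential of the morphism of affine
schemes given by `φ : A → R`. -/
def tangentImage (φ : A →ₐ[k] R) (q : R →ₐ[k] k) : Submodule k (A →ₗ[k] k) :=
  (pointDer q).map (LinearMap.lcomp k k φ.toLinearMap)

theorem mem_tangentImage {φ : A →ₐ[k] R} {q : R →ₐ[k] k} {ε : A →ₗ[k] k} :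
    ε ∈ tangentImage φ q ↔ ∃ δ ∈ pointDer q, δ ∘ₗ φ.toLinearMap = ε := Iff.rfl

/-- The values of the elements of `tangentImage φ q` at a family of elements of `A`. -/
def tangentEval {ι : Type*} (φ : A →ₐ[k] R) (q : R →ₐ[k] k) (f : ι → A) :
    tangentImage φ q →ₗ[k] (ι → k) where
  toFun ε i := ε.1 (f i)
  map_add' _ _ := rfl
  map_smul' _ _ := rfl

/-- At a general point of one component, a derivation of `R` that kills the Noether parameters kills
the generators of `A`, which are integral over them. Hence evaluation on the `s` parameters is
injective on the image. -/
theorem exists_finrank_tangentImage_le [IsAlgClosed k] [CharZero k] [IsReduced R] [Nontrivial R]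
    [Algebra.FiniteType k A] [Algebra.FiniteType k R] (φ : A →ₐ[k] R) {s : ℕ}
    (y : MvPolynomial (Fin s) k →ₐ[k] A) (hy : y.IsIntegral) :
    ∃ q : R →ₐ[k] k, Module.finrank k (tangentImage φ q) ≤ s := by
  classical
  obtain ⟨p, hp⟩ := Ideal.nonempty_minimalPrimes (bot_ne_top (α := Ideal R))
  have : p.IsPrime := hp.1.1
  obtain ⟨t, ht⟩ := Algebra.FiniteType.out (R := k) (A := A)
  have hint : ∀ a : A, ((φ.comp y : MvPolynomial (Fin s) k →ₐ[k] R) :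
      MvPolynomial (Fin s) k →+* R).IsIntegralElem (φ a) := fun a => by
    obtain ⟨Q, hQ, hQa⟩ := hy a
    refine ⟨Q, hQ, ?_⟩
    have := congrArg φ hQa
    rw [map_zero] at this
    rw [← this]
    exact (Polynomial.hom_eval₂ Q (y : MvPolynomial (Fin s) k →+* A) (φ : A →+* R) a).symm
  -- One bad locus for each generator; the product of their equations is still outside `p`, so a
  -- single closed point avoids all of them.
  choose w hwp hw using fun a => exists_pointDer_eq_zero_of_isIntegralElem (k := k) _ hp (hint a)
  have hprod : ∏ a ∈ t, w a ∉ p := fun h => by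
    obtain ⟨a, -, ha⟩ := (Ideal.IsPrime.prod_mem_iff).mp h
    exact hwp a ha
  obtain ⟨q, hq⟩ := exists_algHom_apply_ne_zero (k := k) (w := ∏ a ∈ t, w a)
    fun h => hprod (h ▸ p.zero_mem)
  rw [map_prod, Finset.prod_ne_zero_iff] at hq
  refine ⟨q, ?_⟩
  have hinj : Function.Injective (tangentEval φ q fun i => y (MvPolynomial.X i)) := by
    intro ε ε' h
    refine sub_eq_zero.mp (Subtype.ext ?_)
    obtain ⟨δ, hδ, hε⟩ := mem_tangentImage.mp (ε - ε').2
    have hX : ∀ i, δ (φ (y (MvPolynomial.X i))) = 0 := fun i => by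
      have h1 : (ε - ε').1 (y (MvPolynomial.X i)) = 0 := sub_eq_zero.mpr (congrFun h i)
      rw [← hε] at h1
      exact h1
    have hB := pointDer_eq_zero_of_adjoin (pointDer_comp hδ (φ.comp y)) MvPolynomial.adjoin_range_X
      (by rintro _ ⟨i, rfl⟩; exact hX i)
    rw [← hε]
    exact pointDer_eq_zero_of_adjoin (pointDer_comp hδ φ) ht fun a ha =>
      hw a q (hq a ha) δ hδ fun b => LinearMap.congr_fun hB b
  simpa using LinearMap.finrank_le_finrank_of_injective hinj

/-- Clear denominators on finitely many generators; the Leibniz rule extends this to all of `S`. -/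
theorem exists_common_denominator {S K : Type*} [CommRing S] [IsDomain S] [Algebra k S]
    [Algebra.FiniteType k S] [Field K] [Algebra S K] [IsFractionRing S K] [Algebra k K]
    [IsScalarTower k S K] {ι : Type*} [Finite ι] (D : ι → Derivation k K K) :
    ∃ g : S, g ≠ 0 ∧ ∀ i x, ∃ z, algebraMap S K z = algebraMap S K g * D i (algebraMap S K x) := by
  classical
  cases nonempty_fintype ι
  obtain ⟨t, ht⟩ := Algebra.FiniteType.out (R := k) (A := S)
  obtain ⟨g, hg⟩ := IsLocalization.exist_integer_multiples_of_finset (nonZeroDivisors S)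
    ((Finset.univ ×ˢ t).image fun c : ι × S => D c.1 (algebraMap S K c.2))
  refine ⟨g, nonZeroDivisors.ne_zero g.2, fun i x => ?_⟩
  have hx : x ∈ Algebra.adjoin k (t : Set S) := ht ▸ Algebra.mem_top
  induction hx using Algebra.adjoin_induction with
  | mem x hx =>
    obtain ⟨z, hz⟩ := hg _ (Finset.mem_image_of_mem _
      (Finset.mem_product.mpr ⟨Finset.mem_univ i, hx⟩ : (i, x) ∈ Finset.univ ×ˢ t))
    exact ⟨z, by rw [hz, Algebra.smul_def]⟩
  | algebraMap c =>
    exact ⟨0, by rw [← IsScalarTower.algebraMap_apply, Derivation.map_algebraMap, map_zero,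
      mul_zero]⟩
  | add x x' _ _ hx hx' =>
    obtain ⟨z, hz⟩ := hx
    obtain ⟨z', hz'⟩ := hx'
    exact ⟨z + z', by rw [map_add, map_add, map_add, hz, hz', mul_add]⟩
  | mul x x' _ _ hx hx' =>
    obtain ⟨z, hz⟩ := hx
    obtain ⟨z', hz'⟩ := hx'
    refine ⟨x * z' + x' * z, ?_⟩
    rw [map_add, map_mul, map_mul, map_mul, hz, hz', Derivation.leibniz, smul_eq_mul, smul_eq_mul]
    ring

/-- Derivations dual to the parameters exist on the function field of a subvariety dominating affine
`s`-space. Multiplied by a common denominator `g` they preserve its coordinate ring, and at a point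
with `g ≠ 0` they specialise to `s` independent tangent vectors. -/
theorem exists_le_finrank_tangentImage [IsAlgClosed k] [CharZero k]
    [Algebra.FiniteType k R] (φ : A →ₐ[k] R) {s : ℕ}
    (y : MvPolynomial (Fin s) k →ₐ[k] A) (hy : Function.Injective (φ.comp y)) :
    ∃ q : R →ₐ[k] k, s ≤ Module.finrank k (tangentImage φ q) := by
  classical
  -- A prime avoiding all nonzero polynomials in the parameters, so that these stay algebraically
  -- independent modulo `p`.
  obtain ⟨p, hp, -, hpd⟩ := Ideal.exists_le_prime_disjoint (⊥ : Ideal R)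
    ((nonZeroDivisors (MvPolynomial (Fin s) k)).map (φ.comp y)) (by
      rw [Set.disjoint_left]
      rintro x hx ⟨b, hb, hbx⟩
      have hx0 : x = 0 := hx
      exact nonZeroDivisors.ne_zero hb (hy (by rw [map_zero, ← hx0]; exact hbx)))
  let K := FractionRing (R ⧸ p)
  let π := Ideal.Quotient.mkₐ k p
  let j : (R ⧸ p) →ₐ[k] K := IsScalarTower.toAlgHom k (R ⧸ p) K
  have hj : Function.Injective j := IsFractionRing.injective (R ⧸ p) K
  have hind : AlgebraicIndependent k fun i => j (π (φ (y (MvPolynomial.X i)))) := by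
    have he : MvPolynomial.aeval (fun i => j (π (φ (y (MvPolynomial.X i))))) =
        (j.comp π).comp (φ.comp y) := by
      ext i
      simp
    change Function.Injective (MvPolynomial.aeval _)
    rw [he]
    refine (injective_iff_map_eq_zero _).mpr fun b hb => ?_
    by_contra hb0
    have h1 : π (φ (y b)) = 0 := hj (by rw [map_zero]; exact hb)
    exact Set.disjoint_left.mp hpd (Ideal.Quotient.eq_zero_iff_mem.mp h1)
      ⟨b, mem_nonZeroDivisors_of_ne_zero hb0, rfl⟩
  choose D hD using fun i : Fin s =>
    exists_derivation_of_algebraicIndependent hind (Pi.single i (1 : K))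
  have : Algebra.FiniteType k (R ⧸ p) :=
    Algebra.FiniteType.of_surjective π (Ideal.Quotient.mkₐ_surjective k p)
  obtain ⟨g, hg, hgD⟩ := exists_common_denominator (S := R ⧸ p) D
  obtain ⟨q, hq⟩ := exists_algHom_apply_ne_zero (k := k) hg
  -- `h` is a merely linear retraction of `K` onto `R ⧸ p`. It is applied only to elements of the
  -- image of `j`, so its choice is immaterial.
  obtain ⟨h, hh⟩ := LinearMap.exists_leftInverse_of_injective j.toLinearMap
    (LinearMap.ker_eq_bot.mpr hj)
  have hh' : ∀ z, h (j z) = z := fun z => LinearMap.congr_fun hh z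
  refine ⟨q.comp π, ?_⟩
  let δ : Fin s → R →ₗ[k] k := fun i => q.toLinearMap ∘ₗ h ∘ₗ
    LinearMap.mulLeft k (j g) ∘ₗ (D i : K →ₗ[k] K) ∘ₗ j.toLinearMap ∘ₗ π.toLinearMap
  have hδ : ∀ i x, δ i x = q (h (j g * D i (j (π x)))) := fun i x => rfl
  have hδmem : ∀ i, δ i ∈ pointDer (q.comp π) := by
    intro i a b
    obtain ⟨z, hz⟩ := hgD i (π a)
    obtain ⟨z', hz'⟩ := hgD i (π b)
    change j z = j g * D i (j (π a)) at hz
    change j z' = j g * D i (j (π b)) at hz'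
    have hab : j g * D i (j (π (a * b))) = j (π a * z' + π b * z) := by
      rw [map_mul, map_mul, Derivation.leibniz, map_add, map_mul, map_mul, hz, hz',
        smul_eq_mul, smul_eq_mul]
      ring
    rw [hδ, hδ, hδ, hab, ← hz, ← hz', hh', hh', hh']
    simp
  have hval : ∀ i l, δ i (φ (y (MvPolynomial.X l))) = (Pi.single i (q g) : Fin s → k) l := by
    intro i l
    rw [hδ, hD]
    rcases eq_or_ne l i with rfl | hne
    · simp [hh']
    · simp [hne]
  have hsurj : Function.Surjective (tangentEval φ (q.comp π) fun i => y (MvPolynomial.X i)) := by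
    rw [← LinearMap.range_eq_top, eq_top_iff, ← (Pi.basisFun k (Fin s)).span_eq, Submodule.span_le]
    rintro _ ⟨i, rfl⟩
    refine ⟨(q g)⁻¹ • ⟨δ i ∘ₗ φ.toLinearMap, δ i, hδmem i, rfl⟩, ?_⟩
    ext l
    change (q g)⁻¹ * δ i (φ (y (MvPolynomial.X l))) = _
    rw [hval, Pi.basisFun_apply]
    rcases eq_or_ne l i with rfl | hne
    · simp [hq]
    · simp [hne]
  have : FiniteDimensional k (tangentImage φ (q.comp π)) := by
    unfold tangentImage; infer_instance
  simpa using LinearMap.finrank_le_finrank_of_surjective hsurj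

/-- If the image of the differential of a dominant morphism `Spec R → Spec A` has dimension `r` at
every point of the variety `Spec R`, then `dim A = r`. -/
theorem ringKrullDim_eq_of_finrank_tangentImage [IsAlgClosed k] [CharZero k] [IsReduced R]
    [Nontrivial R] [Algebra.FiniteType k A] [Algebra.FiniteType k R] (φ : A →ₐ[k] R)
    (hφ : Function.Injective φ) {r : ℕ}
    (h : ∀ q : R →ₐ[k] k, Module.finrank k (tangentImage φ q) = r) : ringKrullDim A = r := by
  have : Nontrivial A := φ.toRingHom.domain_nontrivial
  obtain ⟨s, y, hyi, hyf⟩ := exists_integral_inj_algHom_of_fg k A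
  obtain ⟨q, hq⟩ := exists_finrank_tangentImage_le φ y hyf
  obtain ⟨q', hq'⟩ := exists_le_finrank_tangentImage φ y (hφ.comp hyi)
  rw [h] at hq hq'
  obtain rfl := le_antisymm hq hq'
  let := y.toRingHom.toAlgebra
  have : Algebra.IsIntegral (MvPolynomial (Fin r) k) A := ⟨hyf⟩
  rw [ringKrullDim_eq_of_isIntegral_of_injective (A := MvPolynomial (Fin r) k) hyi,
    MvPolynomial.ringKrullDim_of_isNoetherianRing, ringKrullDim_eq_zero_of_field]
  simp

end tangentImage

noncomputable section

universe u

/-! ## Regular functions on an algebraic group -/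

section Regular

variable {k : Type*} [Field k] {n : ℕ}

/-- The values of the variables at a pair of matrices. -/
def pairCoords {B : Type*} (a b : Matrix (Fin n) (Fin n) B) :
    (Fin n × Fin n) ⊕ (Fin n × Fin n) → B :=
  Sum.elim (fun p => a p.1 p.2) (fun p => b p.1 p.2)

/-- A polynomial in the entries of `a` and `a⁻¹` becomes a polynomial in the entries of `a` after
multiplication by a power of `det a`. -/
theorem exists_clear_denominator {k : Type u} [Field k]
    (f : MvPolynomial ((Fin n × Fin n) ⊕ (Fin n × Fin n)) k) :
    ∃ (N : ℕ) (F : MvPolynomial (Fin n × Fin n) k), ∀ (B : Type u) [CommRing B] [Algebra k B]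
      (a b : Matrix (Fin n) (Fin n) B), a * b = 1 →
      MvPolynomial.aeval (fun p : Fin n × Fin n => a p.1 p.2) F =
        a.det ^ N * MvPolynomial.aeval (pairCoords a b) f := by
  induction f using MvPolynomial.induction_on with
  | C c => exact ⟨0, MvPolynomial.C c, fun B _ _ a b _ => by simp⟩
  | add f g hf hg =>
    obtain ⟨N, F, hF⟩ := hf
    obtain ⟨N', F', hF'⟩ := hg
    let d : MvPolynomial (Fin n × Fin n) k := (Matrix.mvPolynomialX (Fin n) (Fin n) k).det
    refine ⟨N + N', d ^ N' * F + d ^ N * F', fun B _ _ a b h => ?_⟩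
    have hd : MvPolynomial.aeval (fun p : Fin n × Fin n => a p.1 p.2) d = a.det := by
      rw [AlgHom.map_det, Matrix.mvPolynomialX_mapMatrix_aeval]
    rw [map_add, map_mul, map_mul, map_pow, map_pow, hd, hF B a b h, hF' B a b h, map_add]
    ring
  | mul_X f p hf =>
    obtain ⟨N, F, hF⟩ := hf
    rcases p with p | p
    · refine ⟨N, F * MvPolynomial.X p, fun B _ _ a b h => ?_⟩
      rw [map_mul, map_mul, hF B a b h, MvPolynomial.aeval_X, MvPolynomial.aeval_X, mul_assoc]
      rfl
    · refine ⟨N + 1, F * (Matrix.mvPolynomialX (Fin n) (Fin n) k).adjugate p.1 p.2,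
        fun B _ _ a b h => ?_⟩
      have hadj : MvPolynomial.aeval (fun p : Fin n × Fin n => a p.1 p.2)
          ((Matrix.mvPolynomialX (Fin n) (Fin n) k).adjugate p.1 p.2) = a.adjugate p.1 p.2 := by
        have := AlgHom.map_adjugate (MvPolynomial.aeval fun p : Fin n × Fin n => a p.1 p.2)
          (Matrix.mvPolynomialX (Fin n) (Fin n) k)
        rw [Matrix.mvPolynomialX_mapMatrix_aeval] at this
        exact congrFun (congrFun this p.1) p.2
      -- Cramer's rule: each entry of the inverse costs one factor `det a`.
      have hab : a.adjugate = a.det • b := by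
        rw [← mul_one a.adjugate, ← h, ← mul_assoc, Matrix.adjugate_mul, Matrix.smul_mul, one_mul]
      rw [map_mul, map_mul, hF B a b h, hadj, hab, MvPolynomial.aeval_X, Matrix.smul_apply,
        smul_eq_mul]
      change _ = _ * (_ * b p.1 p.2)
      ring

/-- The restriction to `H` of a polynomial in the entries of a matrix and of its inverse. -/
def restrict (H : Subgroup (GL (Fin n) k)) :
    MvPolynomial ((Fin n × Fin n) ⊕ (Fin n × Fin n)) k →ₐ[k] (H → k) :=
  AlgHom.pi fun h => MvPolynomial.aeval
    (pairCoords ((h : GL (Fin n) k) : Matrix (Fin n) (Fin n) k)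
      (((h : GL (Fin n) k)⁻¹ : GL (Fin n) k) : Matrix (Fin n) (Fin n) k))

/-- The algebra of regular functions on `H`. -/
def regFun (H : Subgroup (GL (Fin n) k)) : Subalgebra k (H → k) := (restrict H).range

/-- The restriction map onto the algebra of regular functions. -/
def toReg (H : Subgroup (GL (Fin n) k)) :
    MvPolynomial ((Fin n × Fin n) ⊕ (Fin n × Fin n)) k →ₐ[k] regFun H :=
  (restrict H).rangeRestrict

theorem toReg_surjective (H : Subgroup (GL (Fin n) k)) : Function.Surjective (toReg H) :=
  (restrict H).rangeRestrict_surjective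

variable {H : Subgroup (GL (Fin n) k)}

instance : Algebra.FiniteType k (regFun H) :=
  Algebra.FiniteType.of_surjective (toReg H) (toReg_surjective H)

instance : IsReduced (regFun H) :=
  isReduced_of_injective (regFun H).val Subtype.val_injective

/-- The evaluation of regular functions at `h`. -/
def evalAt (h : H) : regFun H →ₐ[k] k := (Pi.evalAlgHom k (fun _ : H => k) h).comp (regFun H).val

variable (H) in
/-- The matrix of the coordinate functions on `H`. -/
def coordMat : Matrix (Fin n) (Fin n) (regFun H) := fun i j =>
  toReg H (MvPolynomial.X (Sum.inl (i, j)))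

variable (H) in
/-- The inverse of the matrix of the coordinate functions on `H`. -/
def coordInv : Matrix (Fin n) (Fin n) (regFun H) := fun i j =>
  toReg H (MvPolynomial.X (Sum.inr (i, j)))

theorem coordMat_map_evalAt (h : H) :
    (coordMat H).map (evalAt h) = ((h : GL (Fin n) k) : Matrix (Fin n) (Fin n) k) := by
  ext i j
  change MvPolynomial.aeval _ (MvPolynomial.X (Sum.inl (i, j))) = _
  rw [MvPolynomial.aeval_X]
  rfl

theorem coordInv_map_evalAt (h : H) : (coordInv H).map (evalAt h) =
    (((h : GL (Fin n) k)⁻¹ : GL (Fin n) k) : Matrix (Fin n) (Fin n) k) := by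
  ext i j
  change MvPolynomial.aeval _ (MvPolynomial.X (Sum.inr (i, j))) = _
  rw [MvPolynomial.aeval_X]
  rfl

theorem regFun_ext {f g : regFun H} (h : ∀ u : H, evalAt u f = evalAt u g) : f = g :=
  Subtype.ext (funext h)

theorem matrix_regFun_ext {M N : Matrix (Fin n) (Fin n) (regFun H)}
    (h : ∀ u : H, M.map (evalAt u) = N.map (evalAt u)) : M = N := by
  refine Matrix.ext fun i j => ?_
  exact regFun_ext fun u => congrFun (congrFun (h u) i) j

theorem coordMat_mul_coordInv : coordMat H * coordInv H = 1 :=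
  matrix_regFun_ext fun u => by
    rw [Matrix.map_mul, coordMat_map_evalAt, coordInv_map_evalAt, Units.mul_inv,
      Matrix.map_one _ (map_zero _) (map_one _)]

theorem restrict_rename_inl {f : MvPolynomial (Fin n × Fin n) k} (h : H) :
    restrict H (MvPolynomial.rename Sum.inl f) h =
      MvPolynomial.eval (coords ((h : GL (Fin n) k) : Matrix (Fin n) (Fin n) k)) f := by
  change MvPolynomial.aeval _ (MvPolynomial.rename Sum.inl f) = _
  rw [MvPolynomial.aeval_rename]
  rfl

theorem toReg_rename_inl_eq_zero {f : MvPolynomial (Fin n × Fin n) k}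
    (hf : f ∈ idealOf (H : Set (GL (Fin n) k))) :
    toReg H (MvPolynomial.rename Sum.inl f) = 0 :=
  Subtype.ext (funext fun h => (restrict_rename_inl h).trans (hf h h.2))

/-- The points of the variety of an algebraic group `H` are the elements of `H`. -/
theorem exists_eq_evalAt (hH : IsAlgebraic H) (q : regFun H →ₐ[k] k) : ∃ h : H, q = evalAt h := by
  have hmul : (coordMat H).map q * (coordInv H).map q = 1 := by
    rw [← Matrix.map_mul, coordMat_mul_coordInv, Matrix.map_one _ (map_zero _) (map_one _)]
  -- The point `q` is read off from its values on the coordinates and their inverses. Since `H` is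
  -- closed, the relations satisfied by `q` put this matrix in `H`.
  let g : GL (Fin n) k := ⟨(coordMat H).map q, (coordInv H).map q, hmul,
    mul_eq_one_comm.mp hmul⟩
  have hg : g ∈ H := by
    obtain ⟨T, hT⟩ := isClosed_zariski_iff.mp hH
    rw [← SetLike.mem_coe, hT]
    intro f hf
    have hfI : f ∈ idealOf (H : Set (GL (Fin n) k)) := fun u hu => by
      rw [hT] at hu
      exact hu f hf
    have h0 := (congrArg q (toReg_rename_inl_eq_zero hfI)).trans (map_zero q)
    rw [← h0]
    have he : (MvPolynomial.aeval (coords (g : Matrix (Fin n) (Fin n) k)) :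
        MvPolynomial (Fin n × Fin n) k →ₐ[k] k) =
        (q.comp (toReg H)).comp (MvPolynomial.rename Sum.inl) := by
      ext p
      simp [coords, g, coordMat]
    exact DFunLike.congr_fun he f
  refine ⟨⟨g, hg⟩, ?_⟩
  have he : q.comp (toReg H) = (evalAt ⟨g, hg⟩).comp (toReg H) := by
    apply MvPolynomial.algHom_ext
    rintro (p | p)
    · exact (congrFun (congrFun (coordMat_map_evalAt ⟨g, hg⟩) p.1) p.2).symm
    · exact (congrFun (congrFun (coordInv_map_evalAt ⟨g, hg⟩) p.1) p.2).symm
  ext f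
  obtain ⟨F, rfl⟩ := toReg_surjective H f
  exact DFunLike.congr_fun he F

/-! ### Tangent vectors -/

theorem pointDer_map_mul {A : Type*} [CommRing A] [Algebra k A] {q : A →ₐ[k] k} {δ : A →ₗ[k] k}
    (hδ : δ ∈ pointDer q) (M N : Matrix (Fin n) (Fin n) A) :
    (M * N).map δ = M.map q * N.map δ + M.map δ * N.map q := by
  ext i j
  simp only [Matrix.map_apply, Matrix.mul_apply, map_sum, pointDer_mul hδ, Matrix.add_apply,
    ← Finset.sum_add_distrib]
  exact Finset.sum_congr rfl fun l _ => by ring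

theorem pointDer_map_const {A : Type*} [CommRing A] [Algebra k A] {q : A →ₐ[k] k} {δ : A →ₗ[k] k}
    (hδ : δ ∈ pointDer q) (Y : Matrix (Fin n) (Fin n) k) : (Y.map (algebraMap k A)).map δ = 0 := by
  ext i j
  exact pointDer_algebraMap hδ _

theorem map_const_map {A : Type*} [CommRing A] [Algebra k A] (q : A →ₐ[k] k)
    (Y : Matrix (Fin n) (Fin n) k) : (Y.map (algebraMap k A)).map q = Y := by
  ext i j
  exact q.commutes _

theorem pointDer_eq_dirDeriv {A Z : Matrix (Fin n) (Fin n) k}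
    {δ : MvPolynomial (Fin n × Fin n) k →ₗ[k] k}
    (hδ : δ ∈ pointDer (MvPolynomial.aeval (coords A))) (h : ∀ p, δ (MvPolynomial.X p) = Z p.1 p.2)
    (f : MvPolynomial (Fin n × Fin n) k) : δ f = dirDeriv A Z f := by
  induction f using MvPolynomial.induction_on with
  | C c => rw [dirDeriv_C]; exact pointDer_algebraMap hδ c
  | add f g hf hg => rw [map_add, dirDeriv_add, hf, hg]
  | mul_X f p hf =>
    rw [pointDer_mul hδ, dirDeriv_mul, hf, h, dirDeriv_X]
    rfl

/-- The point derivation `δ` at `h` is the value at `h` of the left-invariant vector field defined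
by `X`. -/
def IsLeftInvAt (h : H) (X : Matrix (Fin n) (Fin n) k) (δ : regFun H →ₗ[k] k) : Prop :=
  (coordMat H).map δ = ((h : GL (Fin n) k) : Matrix (Fin n) (Fin n) k) * X ∧
    (coordInv H).map δ =
      -(X * (((h : GL (Fin n) k)⁻¹ : GL (Fin n) k) : Matrix (Fin n) (Fin n) k))

/-- Left translation by `h⁻¹` moves the tangent vector `Z` at `h` to `h⁻¹ Z` at 1 and preserves the
ideal of `H`. The formula on inverse coordinates comes from differentiating `h * h⁻¹ = 1`. -/
theorem exists_isLeftInvAt_of_mem_pointDer {h : H} {δ : regFun H →ₗ[k] k}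
    (hδ : δ ∈ pointDer (evalAt h)) : ∃ X ∈ lieAlg H, IsLeftInvAt h X δ := by
  set u : Matrix (Fin n) (Fin n) k := ((h : GL (Fin n) k) : Matrix (Fin n) (Fin n) k) with hu
  set v : Matrix (Fin n) (Fin n) k :=
    (((h : GL (Fin n) k)⁻¹ : GL (Fin n) k) : Matrix (Fin n) (Fin n) k) with hv
  have huv : u * v = 1 := Units.mul_inv _
  have hvu : v * u = 1 := Units.inv_mul _
  set Z := (coordMat H).map δ with hZ
  refine ⟨v * Z, fun f hf => ?_, ?_, ?_⟩
  · have hsub : subst v 1 f ∈ idealOf (H : Set (GL (Fin n) k)) := fun w hw => by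
      rw [eval_subst, mul_one]
      exact hf ((h : GL (Fin n) k)⁻¹ * w) (H.mul_mem (H.inv_mem h.2) hw)
    have h0 := congrArg δ (toReg_rename_inl_eq_zero hsub)
    let ι : MvPolynomial (Fin n × Fin n) k →ₐ[k] regFun H :=
      (toReg H).comp (MvPolynomial.rename Sum.inl)
    have hι : (evalAt h).comp ι = MvPolynomial.aeval (coords u) := by
      apply MvPolynomial.algHom_ext
      intro p
      rw [MvPolynomial.aeval_X]
      have := congrFun (congrFun (coordMat_map_evalAt h) p.1) p.2
      rw [AlgHom.comp_apply, AlgHom.comp_apply, MvPolynomial.rename_X]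
      exact this
    have hmem := pointDer_comp hδ ι
    rw [hι] at hmem
    have h1 := pointDer_eq_dirDeriv (Z := Z) hmem
      (fun p => by
        rw [LinearMap.comp_apply, AlgHom.toLinearMap_apply, AlgHom.comp_apply,
          MvPolynomial.rename_X]
        rfl) (subst v 1 f)
    rw [dirDeriv_subst, mul_one, mul_one, hvu] at h1
    rw [← h1, ← map_zero δ]
    exact h0
  · rw [← mul_assoc, huv, one_mul]
  · have h2 := pointDer_map_mul hδ (coordMat H) (coordInv H)
    have h3 : (1 : Matrix (Fin n) (Fin n) (regFun H)).map δ = 0 := by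
      have := pointDer_map_const hδ (1 : Matrix (Fin n) (Fin n) k)
      rwa [Matrix.map_one _ (map_zero _) (map_one _)] at this
    rw [coordMat_mul_coordInv, h3, coordMat_map_evalAt, coordInv_map_evalAt] at h2
    have h4 := congrArg (v * ·) h2
    simp only [mul_zero, mul_add, ← mul_assoc] at h4
    rw [← hu, ← hv, hvu, one_mul] at h4
    exact eq_neg_of_add_eq_zero_left h4.symm

/-- Over the dual numbers, `A + ε Z`. -/
def dualMat (A Z : Matrix (Fin n) (Fin n) k) : Matrix (Fin n) (Fin n) (DualNumber k) :=
  fun i j => TrivSqZeroExt.inl (A i j) + TrivSqZeroExt.inr (Z i j)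

theorem aeval_dualMat (A Z : Matrix (Fin n) (Fin n) k) (f : MvPolynomial (Fin n × Fin n) k) :
    MvPolynomial.aeval (fun p : Fin n × Fin n => dualMat A Z p.1 p.2) f =
      TrivSqZeroExt.inl (MvPolynomial.eval (coords A) f) +
        TrivSqZeroExt.inr (dirDeriv A Z f) := by
  induction f using MvPolynomial.induction_on with
  | C c => simp [dirDeriv_C, TrivSqZeroExt.algebraMap_eq_inl]
  | add f g hf hg => rw [map_add, hf, hg, dirDeriv_add, map_add]; ext <;> simp
  | mul_X f p hf =>
    rw [map_mul, hf, MvPolynomial.aeval_X, dirDeriv_mul, dirDeriv_X, map_mul, MvPolynomial.eval_X]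
    ext <;> simp [dualMat, coords, mul_comm, add_comm]

/-- The point `h(1 + εX)` over the dual numbers, with inverse `(1 - εX)h⁻¹`, satisfies every
relation holding on `H`; its ε-coefficient is the required derivation. -/
theorem exists_mem_pointDer_isLeftInvAt (h : H) {X : Matrix (Fin n) (Fin n) k}
    (hX : X ∈ lieAlg H) : ∃ δ ∈ pointDer (evalAt h), IsLeftInvAt h X δ := by
  set u : Matrix (Fin n) (Fin n) k := ((h : GL (Fin n) k) : Matrix (Fin n) (Fin n) k) with hu
  set v : Matrix (Fin n) (Fin n) k :=
    (((h : GL (Fin n) k)⁻¹ : GL (Fin n) k) : Matrix (Fin n) (Fin n) k) with hv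
  have huv : u * v = 1 := Units.mul_inv _
  let a := dualMat u (u * X)
  let b := dualMat v (-(X * v))
  have hab : a * b = 1 := by
    ext i j
    · have := congrFun (congrFun huv i) j
      rw [Matrix.mul_apply] at this
      rw [Matrix.mul_apply, TrivSqZeroExt.fst_sum]
      simp only [a, b, dualMat, TrivSqZeroExt.fst_mul, TrivSqZeroExt.fst_add,
        TrivSqZeroExt.fst_inl, TrivSqZeroExt.fst_inr, add_zero, this]
      simp only [Matrix.one_apply]
      split_ifs <;> simp
    · have : u * -(X * v) + u * X * v = 0 := by rw [mul_neg, ← mul_assoc, neg_add_cancel]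
      have := congrFun (congrFun this i) j
      rw [Matrix.add_apply, Matrix.mul_apply, Matrix.mul_apply, ← Finset.sum_add_distrib] at this
      rw [Matrix.mul_apply, TrivSqZeroExt.snd_sum]
      simp only [a, b, dualMat, TrivSqZeroExt.snd_mul, TrivSqZeroExt.fst_add,
        TrivSqZeroExt.fst_inl, TrivSqZeroExt.fst_inr, add_zero, TrivSqZeroExt.snd_add,
        TrivSqZeroExt.snd_inl, TrivSqZeroExt.snd_inr, zero_add, smul_eq_mul,
        MulOpposite.smul_eq_mul_unop, MulOpposite.unop_op, this]
      simp only [Matrix.one_apply]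
      split_ifs <;> simp
  let E : MvPolynomial ((Fin n × Fin n) ⊕ (Fin n × Fin n)) k →ₐ[k] DualNumber k :=
    MvPolynomial.aeval (pairCoords a b)
  -- Membership in `lieAlg H` only concerns polynomials in the matrix entries. So clear the inverse
  -- entries by a power of the determinant, which is a unit at `a`.
  have hker : ∀ f, toReg H f = 0 → E f = 0 := by
    intro f hf
    obtain ⟨N, F, hF⟩ := exists_clear_denominator f
    have hFI : F ∈ idealOf (H : Set (GL (Fin n) k)) := fun w hw => by
      have h1 := hF k (w : Matrix (Fin n) (Fin n) k) ((w⁻¹ : GL (Fin n) k) : Matrix _ _ k)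
        (Units.mul_inv w)
      have h2 : restrict H f ⟨w, hw⟩ = 0 := congrFun (congrArg Subtype.val hf) ⟨w, hw⟩
      change MvPolynomial.aeval _ f = 0 at h2
      rw [h2, mul_zero] at h1
      exact h1
    have h1 := hF (DualNumber k) a b hab
    have h2 : MvPolynomial.aeval (fun p : Fin n × Fin n => a p.1 p.2) F = 0 := by
      rw [aeval_dualMat, ← eval_leftInvDer, leftInvDer_mem hX hFI h h.2, hFI h h.2]
      simp
    rw [h2] at h1
    have hunit : IsUnit (a.det ^ N) := by
      refine IsUnit.pow N (IsUnit.of_mul_eq_one b.det ?_)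
      rw [← Matrix.det_mul, hab, Matrix.det_one]
    exact hunit.mul_right_eq_zero.mp h1.symm
  -- A linear section makes `E` descend to `regFun H`; by `hker` the choice does not matter.
  obtain ⟨s, hs⟩ := (toReg H).toLinearMap.exists_rightInverse_of_surjective
    (LinearMap.range_eq_top.mpr (toReg_surjective H))
  have hs' : ∀ f, toReg H (s f) = f := fun f => LinearMap.congr_fun hs f
  have hE : ∀ f, E (s (toReg H f)) = E f := fun f => by
    rw [← sub_eq_zero, ← map_sub]
    exact hker _ (by rw [map_sub, hs', sub_self])
  have hfst : ∀ f, (E f).fst = evalAt h (toReg H f) := by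
    intro f
    have : (TrivSqZeroExt.fstHom k k k).comp E = (evalAt h).comp (toReg H) := by
      apply MvPolynomial.algHom_ext
      rintro (p | p)
      · have := congrFun (congrFun (coordMat_map_evalAt h) p.1) p.2
        rw [AlgHom.comp_apply, AlgHom.comp_apply, MvPolynomial.aeval_X]
        refine Eq.trans ?_ this.symm
        simp [pairCoords, a, dualMat, hu]
      · have := congrFun (congrFun (coordInv_map_evalAt h) p.1) p.2
        rw [AlgHom.comp_apply, AlgHom.comp_apply, MvPolynomial.aeval_X]
        refine Eq.trans ?_ this.symm
        simp [pairCoords, b, dualMat, hv]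
    exact DFunLike.congr_fun this f
  let δ : regFun H →ₗ[k] k := TrivSqZeroExt.sndHom k k ∘ₗ E.toLinearMap ∘ₗ s
  have hδ : ∀ f, δ (toReg H f) = (E f).snd := fun f => by
    change (E (s _)).snd = _
    rw [hE]
  refine ⟨δ, fun f g => ?_, ?_, ?_⟩
  · obtain ⟨f, rfl⟩ := toReg_surjective H f
    obtain ⟨g, rfl⟩ := toReg_surjective H g
    rw [← map_mul, hδ, hδ, hδ, map_mul, TrivSqZeroExt.snd_mul, hfst, hfst,
      op_smul_eq_smul]
    rfl
  · ext i j
    change δ (toReg H _) = _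
    rw [hδ, MvPolynomial.aeval_X]
    simp [pairCoords, a, dualMat, hu]
  · ext i j
    change δ (toReg H _) = _
    rw [hδ, MvPolynomial.aeval_X]
    simp [pairCoords, b, dualMat, hv]

end Regular

/-! ## Tangent spaces of orbits -/

section OrbitTangent

variable {k : Type*} [Field k] {n : ℕ}

/-- The extension of a linear form on matrices to matrices with entries in an algebra. -/
def extendForm {A : Type*} [CommRing A] [Algebra k A] (ξ : Matrix (Fin n) (Fin n) k →ₗ[k] k)
    (M : Matrix (Fin n) (Fin n) A) : A :=
  ∑ i, ∑ j, ξ (Matrix.single i j 1) • M i j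

theorem map_extendForm {A : Type*} [CommRing A] [Algebra k A]
    (ξ : Matrix (Fin n) (Fin n) k →ₗ[k] k) (M : Matrix (Fin n) (Fin n) A) (δ : A →ₗ[k] k) :
    δ (extendForm ξ M) = ξ (M.map δ) := by
  conv_rhs => rw [Matrix.matrix_eq_sum_single (M.map δ)]
  simp only [extendForm, map_sum, map_smul, smul_eq_mul, Matrix.map_apply]
  refine Finset.sum_congr rfl fun i _ => Finset.sum_congr rfl fun j _ => ?_
  have : Matrix.single i j (δ (M i j)) = δ (M i j) • Matrix.single i j (1 : k) := by
    rw [Matrix.smul_single, smul_eq_mul, mul_one]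
  rw [this, map_smul, smul_eq_mul, mul_comm]

variable {G H : Subgroup (GL (Fin n) k)}

/-- The matrix `h⁻¹ Y h` of regular functions of `h`. -/
def conjInvMat (H : Subgroup (GL (Fin n) k)) (Y : Matrix (Fin n) (Fin n) k) :
    Matrix (Fin n) (Fin n) (regFun H) :=
  coordInv H * Y.map (algebraMap k (regFun H)) * coordMat H

/-- The matrix `h Y h⁻¹` of regular functions of `h`. -/
def conjMat (H : Subgroup (GL (Fin n) k)) (Y : Matrix (Fin n) (Fin n) k) :
    Matrix (Fin n) (Fin n) (regFun H) :=
  coordMat H * Y.map (algebraMap k (regFun H)) * coordInv H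

theorem conjInvMat_map_evalAt (h : H) (Y : Matrix (Fin n) (Fin n) k) :
    (conjInvMat H Y).map (evalAt h) =
      (((h : GL (Fin n) k)⁻¹ : GL (Fin n) k) : Matrix (Fin n) (Fin n) k) * Y *
        ((h : GL (Fin n) k) : Matrix (Fin n) (Fin n) k) := by
  rw [conjInvMat, Matrix.map_mul, Matrix.map_mul, coordInv_map_evalAt, map_const_map,
    coordMat_map_evalAt]

theorem conjMat_map_evalAt (h : H) (Y : Matrix (Fin n) (Fin n) k) :
    (conjMat H Y).map (evalAt h) =
      ((h : GL (Fin n) k) : Matrix (Fin n) (Fin n) k) * Y *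
        (((h : GL (Fin n) k)⁻¹ : GL (Fin n) k) : Matrix (Fin n) (Fin n) k) := by
  rw [conjMat, Matrix.map_mul, Matrix.map_mul, coordInv_map_evalAt, map_const_map,
    coordMat_map_evalAt]

theorem conjInvMat_map_of_isLeftInvAt {h : H} {X : Matrix (Fin n) (Fin n) k}
    {δ : regFun H →ₗ[k] k} (hδ : δ ∈ pointDer (evalAt h)) (hX : IsLeftInvAt h X δ)
    (Y : Matrix (Fin n) (Fin n) k) :
    (conjInvMat H Y).map δ = ⁅(((h : GL (Fin n) k)⁻¹ : GL (Fin n) k) : Matrix (Fin n) (Fin n) k) *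
      Y * ((h : GL (Fin n) k) : Matrix (Fin n) (Fin n) k), X⁆ := by
  rw [conjInvMat, pointDer_map_mul hδ, pointDer_map_mul hδ, pointDer_map_const hδ, hX.1, hX.2,
    Matrix.map_mul, coordInv_map_evalAt, map_const_map, coordMat_map_evalAt, Ring.lie_def]
  noncomm_ring

theorem conjMat_map_of_isLeftInvAt {h : H} {X : Matrix (Fin n) (Fin n) k}
    {δ : regFun H →ₗ[k] k} (hδ : δ ∈ pointDer (evalAt h)) (hX : IsLeftInvAt h X δ)
    (Y : Matrix (Fin n) (Fin n) k) :
    (conjMat H Y).map δ = ((h : GL (Fin n) k) : Matrix (Fin n) (Fin n) k) * ⁅X, Y⁆ *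
      (((h : GL (Fin n) k)⁻¹ : GL (Fin n) k) : Matrix (Fin n) (Fin n) k) := by
  rw [conjMat, pointDer_map_mul hδ, pointDer_map_mul hδ, pointDer_map_const hδ, hX.1, hX.2,
    Matrix.map_mul, coordInv_map_evalAt, map_const_map, coordMat_map_evalAt, Ring.lie_def]
  noncomm_ring

/-- The inclusion of `H` into `G`. -/
def incl (hHG : H ≤ G) (h : H) : G := ⟨h, hHG h.2⟩

theorem exists_extend_lieAlg (x : Module.Dual k (lieAlg G)) :
    ∃ ξ : Matrix (Fin n) (Fin n) k →ₗ[k] k, ∀ Z : lieAlg G, ξ Z = x Z := by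
  obtain ⟨ξ, hξ⟩ := LinearMap.exists_extend (p := (lieAlg G).toSubmodule) x
  exact ⟨ξ, fun Z => LinearMap.congr_fun hξ Z⟩

theorem exists_dual_eq_eval (l : Module.Dual k (Module.Dual k (lieAlg G))) :
    ∃ Y : lieAlg G, ∀ x, l x = x Y := by
  obtain ⟨Y, rfl⟩ := (Module.evalEquiv k (lieAlg G)).surjective l
  exact ⟨Y, fun x => rfl⟩

/-- With `l` evaluation at `Y` and `ξ` an extension of `x` to all matrices, `l(h·x) = ξ(h⁻¹Yh)` is
visibly regular. Its derivative along `hX` is `ξ([h⁻¹Yh, X])`, which is `l(h·[X, x])`. -/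
theorem exists_regFun_coAd (hHG : H ≤ G) (x : Module.Dual k (lieAlg G))
    (l : Module.Dual k (Module.Dual k (lieAlg G))) : ∃ f : regFun H,
      (∀ h : H, f.1 h = l (coAd G (incl hHG h) x)) ∧
      ∀ (h : H) (δ : regFun H →ₗ[k] k), δ ∈ pointDer (evalAt h) → ∀ X : lieAlg G,
        IsLeftInvAt h X δ → δ f = l (coAd G (incl hHG h) ⁅X, x⁆) := by
  obtain ⟨ξ, hξ⟩ := exists_extend_lieAlg x
  obtain ⟨Y, hY⟩ := exists_dual_eq_eval l
  refine ⟨extendForm ξ (conjInvMat H Y), fun h => ?_, fun h δ hδ X hX => ?_⟩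
  · rw [hY]
    refine (map_extendForm ξ _ (evalAt h).toLinearMap).trans ?_
    change ξ ((conjInvMat H Y).map (evalAt h)) = x (Ad G (incl hHG h)⁻¹ Y)
    rw [conjInvMat_map_evalAt, ← hξ]
    congr 1
  · rw [hY, map_extendForm, conjInvMat_map_of_isLeftInvAt hδ hX]
    change _ = ⁅X, x⁆ (Ad G (incl hHG h)⁻¹ Y)
    rw [Module.Dual.lie_apply, ← map_neg, lie_skew, ← hξ]
    congr 1

/-- The comorphism of the orbit map `H → H · x`. -/
def orbitComorphism (hHG : H ≤ G) (x : Module.Dual k (lieAlg G)) :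
    coordRing (k := k) (orbit (coAd G) H x) →ₐ[k] regFun H :=
  ((AlgHom.pi fun h : H => Pi.evalAlgHom k (fun _ : orbit (coAd G) H x => k)
    ⟨coAd G (incl hHG h) x, incl hHG h, h.2, rfl⟩).comp
      (coordRing (k := k) (orbit (coAd G) H x)).val).codRestrict (regFun H) (by
    rintro ⟨f, hf⟩
    induction hf using Algebra.adjoin_induction with
    | mem f hf =>
      obtain ⟨l, rfl⟩ := hf
      obtain ⟨F, hF, -⟩ := exists_regFun_coAd hHG x l
      have hmem := F.2
      rw [show F.1 = _ from funext hF] at hmem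
      exact hmem
    | algebraMap c => exact (regFun H).algebraMap_mem c
    | add f g _ _ hf hg => exact (regFun H).add_mem hf hg
    | mul f g _ _ hf hg => exact (regFun H).mul_mem hf hg)

theorem orbitComorphism_injective (hHG : H ≤ G) (x : Module.Dual k (lieAlg G)) :
    Function.Injective (orbitComorphism hHG x) := by
  intro f g hfg
  refine Subtype.ext (funext ?_)
  rintro ⟨_, u, hu, rfl⟩
  exact congrFun (congrArg Subtype.val hfg) ⟨u, hu⟩

/-- The restriction of linear forms to a subset `S` of a vector space. -/
def linForm {V : Type*} [AddCommGroup V] [Module k V] (S : Set V) :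
    Module.Dual k V →ₗ[k] coordRing (k := k) S where
  toFun l := ⟨fun s => l s, Algebra.subset_adjoin ⟨l, rfl⟩⟩
  map_add' _ _ := rfl
  map_smul' _ _ := rfl

theorem adjoin_range_linForm {V : Type*} [AddCommGroup V] [Module k V] (S : Set V) :
    Algebra.adjoin k (Set.range (linForm (k := k) S)) = ⊤ := by
  have := Algebra.adjoin_adjoin_coe_preimage (R := k)
    (s := Set.range fun (l : Module.Dual k V) (s : S) => l s)
  refine Eq.trans (congrArg _ ?_) this
  ext f
  exact ⟨fun ⟨l, hl⟩ => ⟨l, congrArg Subtype.val hl⟩, fun ⟨l, hl⟩ => ⟨l, Subtype.ext hl⟩⟩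

instance {V : Type*} [AddCommGroup V] [Module k V] [FiniteDimensional k V] (S : Set V) :
    Algebra.FiniteType k (coordRing (k := k) S) := by
  classical
  let b := Module.finBasis k (Module.Dual k V)
  have hr : Set.range (linForm (k := k) S) ⊆
      Algebra.adjoin k (Set.range fun i => linForm (k := k) S (b i)) := by
    rintro _ ⟨l, rfl⟩
    rw [← b.sum_repr l, map_sum]
    refine Subalgebra.sum_mem _ fun i _ => ?_
    rw [map_smul]
    exact Subalgebra.smul_mem _ (Algebra.subset_adjoin (Set.mem_range_self i)) _
  refine ⟨⟨Finset.univ.image fun i => linForm (k := k) S (b i), ?_⟩⟩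
  rw [Finset.coe_image, Finset.coe_univ, Set.image_univ, eq_top_iff,
    ← adjoin_range_linForm (k := k) S]
  exact Algebra.adjoin_le hr

/-- A point derivation is determined by its values on generators, so tangent vectors of a subset of
`V` may be computed on linear forms alone. -/
theorem finrank_map_lcomp_of_adjoin {A L : Type*} [CommRing A] [Algebra k A] [AddCommGroup L]
    [Module k L] (g : L →ₗ[k] A) (hg : Algebra.adjoin k (Set.range g) = ⊤) {q : A →ₐ[k] k}
    {T : Submodule k (A →ₗ[k] k)} (hT : T ≤ pointDer q) :
    Module.finrank k (T.map (LinearMap.lcomp k k g)) = Module.finrank k T := by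
  have hinj : Function.Injective ((LinearMap.lcomp k k g).domRestrict T) := by
    intro ε ε' hε
    refine sub_eq_zero.mp (Subtype.ext (pointDer_eq_zero_of_adjoin (hT (ε - ε').2) hg ?_))
    rintro _ ⟨l, rfl⟩
    exact sub_eq_zero.mpr (LinearMap.congr_fun hε l)
  rw [← LinearMap.finrank_range_of_inj hinj, LinearMap.range_domRestrict]

theorem tangentImage_le_pointDer {A R : Type*} [CommRing A] [Algebra k A] [CommRing R]
    [Algebra k R] (φ : A →ₐ[k] R) (q : R →ₐ[k] k) : tangentImage φ q ≤ pointDer (q.comp φ) := by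
  rintro _ ⟨δ, hδ, rfl⟩
  exact pointDer_comp hδ φ

theorem lieAlg_mono (hHG : H ≤ G) {X : Matrix (Fin n) (Fin n) k} (hX : X ∈ lieAlg H) :
    X ∈ lieAlg G := fun f hf => hX f fun g hg => hf g (hHG hg)

/-- Viewed in the ambient space, the image of the differential at `h` is `h·[𝔥, x]`, and `h` acts
invertibly. -/
theorem finrank_tangentImage_orbitComorphism (hHG : H ≤ G) (x : Module.Dual k (lieAlg G)) (h : H) :
    Module.finrank k (tangentImage (orbitComorphism hHG x) (evalAt h)) =
      Module.finrank k (bracketSpace (lieSub G H) x) := by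
  let Γ := LinearMap.lcomp k k (linForm (k := k) (orbit (coAd G) H x))
  -- A vector `y` goes to evaluation at `h·y`, so that it can be compared with tangent vectors
  -- restricted to linear forms.
  let e : Module.Dual k (lieAlg G) →ₗ[k] Module.Dual k (Module.Dual k (Module.Dual k (lieAlg G))) :=
    Module.Dual.eval k _ ∘ₗ coAd G (incl hHG h)
  have he : Function.Injective e := by
    refine (Module.eval_apply_injective k).comp ?_
    refine Function.LeftInverse.injective (g := coAd G (incl hHG h)⁻¹) fun y => ?_
    rw [← Module.End.mul_apply, ← map_mul, inv_mul_cancel, map_one, Module.End.one_apply]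
  have hval : ∀ (l : Module.Dual k (Module.Dual k (lieAlg G))) (δ : regFun H →ₗ[k] k),
      δ ∈ pointDer (evalAt h) → ∀ X : lieAlg G, IsLeftInvAt h X δ →
      δ (orbitComorphism hHG x (linForm _ l)) = e ⁅X, x⁆ l := by
    intro l δ hδ X hX
    obtain ⟨f, hf, hf'⟩ := exists_regFun_coAd hHG x l
    have : orbitComorphism hHG x (linForm _ l) = f :=
      Subtype.ext (funext fun u => (hf u).symm)
    rw [this, hf' h δ hδ X hX]
    rfl
  have himage : (tangentImage (orbitComorphism hHG x) (evalAt h)).map Γ =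
      (bracketSpace (lieSub G H) x).map e := by
    ext ζ
    constructor
    · rintro ⟨_, ⟨δ, hδ, rfl⟩, rfl⟩
      obtain ⟨X, hX, hXδ⟩ := exists_isLeftInvAt_of_mem_pointDer hδ
      refine ⟨⁅(⟨X, lieAlg_mono hHG hX⟩ : lieAlg G), x⁆, ⟨_, hX, rfl⟩, ?_⟩
      ext l
      exact (hval l δ hδ ⟨X, lieAlg_mono hHG hX⟩ hXδ).symm
    · rintro ⟨_, ⟨X, hX, rfl⟩, rfl⟩
      obtain ⟨δ, hδ, hXδ⟩ := exists_mem_pointDer_isLeftInvAt h hX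
      refine ⟨_, ⟨δ, hδ, rfl⟩, ?_⟩
      ext l
      exact hval l δ hδ X hXδ
  rw [← finrank_map_lcomp_of_adjoin _ (adjoin_range_linForm _) (tangentImage_le_pointDer _ _),
    himage]
  exact LinearEquiv.finrank_eq (Submodule.equivMapOfInjective e he _).symm

end OrbitTangent

/-! ### Dimensions of orbits. -/

section Dimension

variable {k : Type*} [Field k] {n : ℕ} {G H : Subgroup (GL (Fin n) k)}

theorem dimension_orbit_coAd [IsAlgClosed k] [CharZero k] (hH : IsAlgebraic H) (hHG : H ≤ G)
    (x : Module.Dual k (lieAlg G)) :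
    dimension (k := k) (orbit (coAd G) H x) =
      ((Module.finrank k (bracketSpace (lieSub G H) x) : ℕ) : WithBot ℕ∞) := by
  refine ringKrullDim_eq_of_finrank_tangentImage (orbitComorphism hHG x)
    (orbitComorphism_injective hHG x) fun q => ?_
  obtain ⟨h, rfl⟩ := exists_eq_evalAt hH q
  exact finrank_tangentImage_orbitComorphism hHG x h

theorem dimension_image {V W : Type*} [AddCommGroup V] [Module k V] [AddCommGroup W] [Module k W]
    (e : V ≃ₗ[k] W) (S : Set V) : dimension (k := k) (e '' S) = dimension (k := k) S := by
  let Φ : ((e '' S : Set W) → k) →ₐ[k] (S → k) :=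
    AlgHom.pi fun s => Pi.evalAlgHom k (fun _ : (e '' S : Set W) => k) ⟨e s, s, s.2, rfl⟩
  have hΦ : Function.Injective Φ := by
    intro f g hfg
    ext ⟨_, s, hs, rfl⟩
    exact congrFun hfg ⟨s, hs⟩
  have hmap : (coordRing (k := k) (e '' S)).map Φ = coordRing (k := k) S := by
    rw [coordRing, AlgHom.map_adjoin, coordRing]
    congr 1
    ext f
    constructor
    · rintro ⟨_, ⟨l, rfl⟩, rfl⟩
      exact ⟨l ∘ₗ e.toLinearMap, rfl⟩
    · rintro ⟨l, rfl⟩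
      refine ⟨_, ⟨l ∘ₗ e.symm.toLinearMap, rfl⟩, funext fun s => ?_⟩
      exact congrArg l (e.symm_apply_apply s)
  rw [dimension, dimension, ← hmap]
  exact ringKrullDim_eq_of_ringEquiv
    ((coordRing (k := k) (e '' S)).equivMapOfInjective Φ hΦ).toRingEquiv

end Dimension

/-! ### Linear algebra of the skew form attached to x. -/

section CoadjointLinearAlgebra

variable {k L : Type*} [Field k] [LieRing L] [LieAlgebra k L]

theorem bracketSpace_le_inf_dualAnnihilator {K : Submodule k L}
    (hK : ∀ X ∈ K, ∀ Y ∈ K, ⁅X, Y⁆ ∈ K) {x : Module.Dual k L} (hx : x ∈ K.dualAnnihilator) :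
    bracketSpace K x ≤ bracketSpace (⊤ : Submodule k L) x ⊓ K.dualAnnihilator := by
  rintro _ ⟨X, hX, rfl⟩
  refine ⟨⟨X, trivial, rfl⟩, (Submodule.mem_dualAnnihilator _).mpr fun Y hY => ?_⟩
  change ⁅X, x⁆ Y = 0
  rw [Module.Dual.lie_apply, (Submodule.mem_dualAnnihilator _).mp hx _ (hK X hX Y hY), neg_zero]

/-- Rank–nullity for the restriction [𝔤, x] → K*. No bracket condition on `K` and no vanishing of
`x` on `K` is needed: only skewness of `T`, which identifies the image with that of the transpose of
`T` restricted to `K`. -/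
theorem finrank_bracketSpace_top [FiniteDimensional k L] (K : Submodule k L)
    (x : Module.Dual k L) :
    Module.finrank k (bracketSpace (⊤ : Submodule k L) x) =
      Module.finrank k (bracketSpace K x) +
        Module.finrank k ↥(bracketSpace (⊤ : Submodule k L) x ⊓ K.dualAnnihilator) := by
  let T : L →ₗ[k] Module.Dual k L :=
    (LieModule.toEnd k L (Module.Dual k L) : L →ₗ[k] Module.End k (Module.Dual k L)).flip x
  have hT : ∀ X Y, T X Y = -x ⁅X, Y⁆ := fun X Y => rfl
  have hskew : ∀ X Y, T X Y = -T Y X := fun X Y => by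
    rw [hT, hT, ← lie_skew, map_neg]
  let S : Submodule k (Module.Dual k L) := bracketSpace (⊤ : Submodule k L) x
  have hS : S = LinearMap.range T := LinearMap.range_eq_map T ▸ rfl
  let res : Module.Dual k L →ₗ[k] Module.Dual k K := K.dualRestrict
  have hker : (LinearMap.ker (res.domRestrict S)).map S.subtype = S ⊓ K.dualAnnihilator := by
    rw [LinearMap.ker_domRestrict, Submodule.map_comap_subtype,
      Submodule.dualRestrict_ker_eq_dualAnnihilator]
  have hrange : LinearMap.range (res.domRestrict S) = LinearMap.range (T.domRestrict K).dualMap := by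
    rw [LinearMap.range_domRestrict, hS, ← LinearMap.range_comp]
    ext ζ
    constructor
    · rintro ⟨X, rfl⟩
      refine ⟨-Module.Dual.eval k L X, ?_⟩
      ext Y
      change -T Y X = T X Y
      rw [← hskew]
    · rintro ⟨η, rfl⟩
      obtain ⟨X, rfl⟩ := (Module.evalEquiv k L).surjective η
      refine ⟨-X, ?_⟩
      ext Y
      change T (-X) Y = T Y X
      rw [map_neg, LinearMap.neg_apply, ← hskew]
  have h1 := LinearMap.finrank_range_add_finrank_ker (K := k) (V := S) (res.domRestrict S)
  rw [hrange, LinearMap.finrank_range_dualMap_eq_finrank_range, LinearMap.range_domRestrict,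
    ← LinearEquiv.finrank_eq (Submodule.equivMapOfInjective S.subtype S.injective_subtype _).symm,
    hker] at h1
  exact h1.symm

end CoadjointLinearAlgebra

/-! ### Transport between 𝔤 and its dual by an invariant form. -/

section InvariantForm

variable {k : Type*} [Field k] {n : ℕ} {G H : Subgroup (GL (Fin n) k)}

theorem IsInvariantForm.coAd_apply {Ψ : LinearMap.BilinForm k (lieAlg G)} (hΨ : IsInvariantForm Ψ)
    (g : G) (x : lieAlg G) : coAd G g (Ψ x) = Ψ (Ad G g x) := by
  ext Y
  change Ψ x (Ad G g⁻¹ Y) = _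
  rw [← hΨ g, ← Module.End.mul_apply, ← map_mul, mul_inv_cancel, map_one, Module.End.one_apply]

/-- A form that is invariant under `G` is invariant under the Lie algebra of `G`. -/
theorem IsInvariantForm.lie_apply {Ψ : LinearMap.BilinForm k (lieAlg G)} (hΨ : IsInvariantForm Ψ)
    (X x : lieAlg G) : ⁅X, Ψ x⁆ = Ψ ⁅X, x⁆ := by
  ext Z
  obtain ⟨ξ, hξ⟩ := exists_extend_lieAlg (Ψ x)
  obtain ⟨η, hη⟩ := exists_extend_lieAlg (Ψ.flip Z)
  obtain ⟨δ, hδ, hX⟩ := exists_mem_pointDer_isLeftInvAt (1 : G) X.2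
  -- Invariance says that `u ↦ Ψ(x, u⁻¹Zu)` and `u ↦ Ψ(uxu⁻¹, Z)` are the same regular function on
  -- `G`; differentiate it at 1 along `X`.
  have hfun : extendForm ξ (conjInvMat G Z) = extendForm η (conjMat G x) := by
    refine regFun_ext fun u => ?_
    refine (map_extendForm ξ _ (evalAt u).toLinearMap).trans
      (Eq.trans ?_ (map_extendForm η _ (evalAt u).toLinearMap).symm)
    change ξ ((conjInvMat G Z).map (evalAt u)) = η ((conjMat G x).map (evalAt u))
    rw [conjInvMat_map_evalAt, conjMat_map_evalAt]
    have h1 := hξ (Ad G u⁻¹ Z)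
    have h2 := hη (Ad G u x)
    have h3 : Ψ x (Ad G u⁻¹ Z) = Ψ (Ad G u x) Z :=
      LinearMap.congr_fun (hΨ.coAd_apply u x) Z
    refine Eq.trans ?_ ((h1.trans (h3.trans h2.symm)))
    congr 1
  have h := congrArg δ hfun
  rw [map_extendForm, map_extendForm, conjInvMat_map_of_isLeftInvAt hδ hX,
    conjMat_map_of_isLeftInvAt hδ hX] at h
  have h1 := hξ ⁅Z, X⁆
  have h2 := hη ⁅X, x⁆
  rw [Module.Dual.lie_apply, ← map_neg, lie_skew, ← h1]
  refine Eq.trans ?_ h2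
  simpa using h

theorem IsInvariantForm.map_bracketSpace {Ψ : LinearMap.BilinForm k (lieAlg G)}
    (hΨ : IsInvariantForm Ψ) (K : Submodule k (lieAlg G)) (x : lieAlg G) :
    (bracketSpace K x).map Ψ = bracketSpace K (Ψ x) := by
  ext ζ
  constructor
  · rintro ⟨_, ⟨X, hX, rfl⟩, rfl⟩
    exact ⟨X, hX, hΨ.lie_apply X x⟩
  · rintro ⟨X, hX, rfl⟩
    exact ⟨_, ⟨X, hX, rfl⟩, (hΨ.lie_apply X x).symm⟩

theorem IsInvariantForm.image_orbit {Ψ : LinearMap.BilinForm k (lieAlg G)}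
    (hΨ : IsInvariantForm Ψ) (H : Subgroup (GL (Fin n) k)) (x : lieAlg G) :
    Ψ '' orbit (Ad G) H x = orbit (coAd G) H (Ψ x) := by
  ext ζ
  constructor
  · rintro ⟨_, ⟨g, hg, rfl⟩, rfl⟩
    exact ⟨g, hg, (hΨ.coAd_apply g x).symm⟩
  · rintro ⟨g, hg, rfl⟩
    exact ⟨_, ⟨g, hg, rfl⟩, (hΨ.coAd_apply g x).symm⟩

end InvariantForm

/-! ### Assembly of the two assertions. -/

theorem lieSub_self {k : Type*} [Field k] {n : ℕ} (G : Subgroup (GL (Fin n) k)) :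
    lieSub G G = ⊤ :=
  eq_top_iff.mpr fun X _ => X.2

/-- Put a = dim [𝔥, x] and b = dim ([𝔤, x] ∩ 𝔪). Then dim G·x = a + b with a ≤ b, and a = b exactly
when the nested subspaces coincide. -/
theorem coadjoint_orbit_dimensions {k : Type*} [Field k] [IsAlgClosed k] [CharZero k] {n : ℕ}
    {G H : Subgroup (GL (Fin n) k)} (hG : IsAlgebraic G) (hH : IsAlgebraic H) (hHG : H ≤ G)
    {x : Module.Dual k (lieAlg G)} (hx : x ∈ (lieSub G H).dualAnnihilator) :
    dimension (k := k) (orbit (coAd G) G x) = dimension (k := k) (orbit (coAd G) H x)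
        + (Module.finrank k ↥(bracketSpace (⊤ : Submodule k (lieAlg G)) x
            ⊓ (lieSub G H).dualAnnihilator) : ℕ) ∧
      2 * dimension (k := k) (orbit (coAd G) H x) ≤ dimension (k := k) (orbit (coAd G) G x) ∧
      (dimension (k := k) (orbit (coAd G) G x) = 2 * dimension (k := k) (orbit (coAd G) H x) ↔
        bracketSpace (⊤ : Submodule k (lieAlg G)) x ⊓ (lieSub G H).dualAnnihilator
          = bracketSpace (lieSub G H) x) := by
  have hle : bracketSpace (lieSub G H) x ≤
      bracketSpace (⊤ : Submodule k (lieAlg G)) x ⊓ (lieSub G H).dualAnnihilator :=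
    bracketSpace_le_inf_dualAnnihilator (K := lieSub G H) (fun X hX Y hY => (lieAlg H).lie_mem hX hY) hx
  have hrank := finrank_bracketSpace_top (lieSub G H) x
  have hmono := Submodule.finrank_mono hle
  rw [dimension_orbit_coAd hG le_rfl, dimension_orbit_coAd hH hHG, lieSub_self, hrank]
  refine ⟨by norm_cast, ?_, ?_⟩
  · rw [two_mul]
    exact_mod_cast Nat.add_le_add_left hmono _
  · rw [two_mul]
    constructor
    · intro h
      have h' : Module.finrank k (bracketSpace (lieSub G H) x) +
          Module.finrank k ↥(bracketSpace (⊤ : Submodule k (lieAlg G)) x ⊓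
            (lieSub G H).dualAnnihilator) =
          Module.finrank k (bracketSpace (lieSub G H) x) +
          Module.finrank k (bracketSpace (lieSub G H) x) := by exact_mod_cast h
      exact (Submodule.eq_of_le_of_finrank_eq hle (by omega)).symm
    · intro h
      rw [h]
      norm_cast

end

end AlgGrp

theorem mainTheorem7 {k : Type*} [Field k] [IsAlgClosed k] [CharZero k] {n : ℕ}
    (G H : Subgroup (GL (Fin n) k)) (hG : AlgGrp.IsConnReductive G)
    (hH : AlgGrp.IsAlgebraic H) (hHG : H ≤ G) :
    -- `𝔪 = 𝔥^⊥` in the dual of `𝔤`, with the coadjoint action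
    (∀ x : Module.Dual k (AlgGrp.lieAlg G), x ∈ (AlgGrp.lieSub G H).dualAnnihilator →
      AlgGrp.dimension (k := k) (AlgGrp.orbit (AlgGrp.coAd G) G x)
          = AlgGrp.dimension (k := k) (AlgGrp.orbit (AlgGrp.coAd G) H x)
            + (Module.finrank k ↥(AlgGrp.bracketSpace (⊤ : Submodule k (AlgGrp.lieAlg G)) x
                ⊓ (AlgGrp.lieSub G H).dualAnnihilator) : ℕ) ∧
      2 * AlgGrp.dimension (k := k) (AlgGrp.orbit (AlgGrp.coAd G) H x)
          ≤ AlgGrp.dimension (k := k) (AlgGrp.orbit (AlgGrp.coAd G) G x) ∧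
      (AlgGrp.dimension (k := k) (AlgGrp.orbit (AlgGrp.coAd G) G x)
            = 2 * AlgGrp.dimension (k := k) (AlgGrp.orbit (AlgGrp.coAd G) H x) ↔
        AlgGrp.bracketSpace (⊤ : Submodule k (AlgGrp.lieAlg G)) x
            ⊓ (AlgGrp.lieSub G H).dualAnnihilator
          = AlgGrp.bracketSpace (AlgGrp.lieSub G H) x)) ∧
    -- `𝔤` identified with its dual by an invariant form `Ψ`; `𝔪` as a subspace of `𝔤`
    (∀ Ψ : LinearMap.BilinForm k (AlgGrp.lieAlg G), Ψ.Nondegenerate → AlgGrp.IsInvariantForm Ψ →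
      ∀ x : AlgGrp.lieAlg G, x ∈ (AlgGrp.lieSub G H).dualAnnihilator.comap Ψ →
      AlgGrp.dimension (k := k) (AlgGrp.orbit (AlgGrp.Ad G) G x)
          = AlgGrp.dimension (k := k) (AlgGrp.orbit (AlgGrp.Ad G) H x)
            + (Module.finrank k ↥(AlgGrp.bracketSpace (⊤ : Submodule k (AlgGrp.lieAlg G)) x
                ⊓ (AlgGrp.lieSub G H).dualAnnihilator.comap Ψ) : ℕ) ∧
      2 * AlgGrp.dimension (k := k) (AlgGrp.orbit (AlgGrp.Ad G) H x)
          ≤ AlgGrp.dimension (k := k) (AlgGrp.orbit (AlgGrp.Ad G) G x) ∧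
      (AlgGrp.dimension (k := k) (AlgGrp.orbit (AlgGrp.Ad G) G x)
            = 2 * AlgGrp.dimension (k := k) (AlgGrp.orbit (AlgGrp.Ad G) H x) ↔
        AlgGrp.bracketSpace (⊤ : Submodule k (AlgGrp.lieAlg G)) x
            ⊓ (AlgGrp.lieSub G H).dualAnnihilator.comap Ψ
          = AlgGrp.bracketSpace (AlgGrp.lieSub G H) x)) := by
  refine ⟨fun x hx => AlgGrp.coadjoint_orbit_dimensions hG.isAlgebraic hH hHG hx,
    fun Ψ hΨ hinv x hx => ?_⟩
  have hinj : Function.Injective Ψ :=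
    LinearMap.ker_eq_bot.mp (LinearMap.separatingLeft_iff_ker_eq_bot.mp hΨ.1)
  let e : AlgGrp.lieAlg G ≃ₗ[k] Module.Dual k (AlgGrp.lieAlg G) :=
    LinearEquiv.ofInjectiveOfFinrankEq Ψ hinj Subspace.dual_finrank_eq.symm
  have hdim : ∀ K : Subgroup (GL (Fin n) k),
      AlgGrp.dimension (k := k) (AlgGrp.orbit (AlgGrp.Ad G) K x) =
        AlgGrp.dimension (k := k) (AlgGrp.orbit (AlgGrp.coAd G) K (Ψ x)) := fun K => by
    rw [← hinv.image_orbit K x]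
    exact (AlgGrp.dimension_image e _).symm
  -- `Ψ` carries [𝔤, x] ∩ 𝔪_Ψ onto [𝔤, Ψ x] ∩ 𝔪; surjectivity is needed so that 𝔪_Ψ fills all of 𝔪.
  have hmap : (AlgGrp.bracketSpace (⊤ : Submodule k (AlgGrp.lieAlg G)) x
      ⊓ (AlgGrp.lieSub G H).dualAnnihilator.comap Ψ).map Ψ =
      AlgGrp.bracketSpace (⊤ : Submodule k (AlgGrp.lieAlg G)) (Ψ x)
        ⊓ (AlgGrp.lieSub G H).dualAnnihilator := by
    rw [Submodule.map_inf _ hinj, hinv.map_bracketSpace,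
      Submodule.map_comap_eq_of_surjective (f := Ψ) e.surjective]
  obtain ⟨h1, h2, h3⟩ := AlgGrp.coadjoint_orbit_dimensions hG.isAlgebraic hH hHG (x := Ψ x) hx
  rw [hdim, hdim, ← (Submodule.map_injective_of_injective hinj).eq_iff, hmap,
    hinv.map_bracketSpace, LinearEquiv.finrank_eq (Submodule.equivMapOfInjective Ψ hinj _), hmap]
  exact ⟨h1, h2, h3⟩
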